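/- Let $d\ge 2$. On $\mathbb C^d\otimes\mathbb C^d$ let $V$ be the flip operator, $V(\varphi\otimes\psi)=\psi\otimes\varphi$, and let $\Gamma=\mathrm{id}\otimes T$ be the partial transpose. For states $\varrho,\sigma$ put $$B_2(\varrho,\sigma)=2\log_2 d+S(\varrho|\sigma)+\log_2\|\sigma^\Gamma\|_{op},\qquad B_2(\varrho)=\inf_{\sigma}B_2(\varrho,\sigma),$$ where $\sigma$ ranges over all states, $\|\cdot\|_{op}$ is the operator norm, $S(\varrho|\sigma)=\mathrm{tr}\,\varrho\log_2\varrho-\mathrm{tr}\,\varrho\log_2\sigma$ is the relative entropy ($+\infty$ unless $\mathrm{supp}\,\varrho\subseteq\mathrm{supp}\,\sigma$) and $S(\varrho)=-\mathrm{tr}\,\varrho\log_2\varrho$ is the von Neumann entropy. A state $\sigma$ is optimal for $\varrho$ if $B_2(\varrho,\sigma)=B_2(\varrho)$. For $-1\le\beta\le 1$ let $$\varrho_\beta=\frac{I+\beta V}{d^2+d\beta},\qquad p_S=\frac{d^2+d}{2}\,\frac{1+\beta}{d^2+d\beta},\qquad p_A=\frac{d^2-d}{2}\,\frac{1-\beta}{d^2+d\beta}$$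 (the Werner states). Throughout $0\log_2 0=0$. Then $\varrho_\beta$ is a state with $$S(\varrho_\beta)=-p_A\log_2\frac{1-\beta}{d^2+d\beta}-p_S\log_2\frac{1+\beta}{d^2+d\beta},$$ and the following hold. (1) For every state $\sigma$, the twirled operator $\tilde\sigma=\int_{U(d)}(U\otimes U)\,\sigma\,(U\otimes U)^\dagger\,dU$ (normalised Haar measure) is a state, equals $\varrho_\alpha$ for some $\alpha\in[-1,1]$, and satisfies $B_2(\varrho_\beta,\tilde\sigma)\le B_2(\varrho_\beta,\sigma)$. Hence $B_2(\varrho_\beta)=\inf_{-1\le\alpha\le1}B_2(\varrho_\beta,\varrho_\alpha)$. (2) With $\alpha=\dfrac{1+d\beta}{d+\beta}$, $$B_2(\varrho_\beta)=\begin{cases} 2\log_2 d-S(\varrho_\beta)-p_S\log_2\frac{d-2}{d}-p_A\log_2\frac{d+2}{d}, & -1\le\beta<\frac{-3d}{d^2+2},\\[1mm] 2\log_2 d-S(\varrho_\beta)-p_S\log_2(1+\alpha)-p_A\log_2(1-\alpha), & \frac{-3d}{d^2+2}\le\beta<-\frac1d,\\[1mm] 2\log_2 d-S(\varrho_\beta),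 & -\frac1d\le\beta\le1, \end{cases}$$ and in these three cases the Werner states $\varrho_{-2/d}$, $\varrho_\alpha$ and $\varrho_0=I/d^2$, respectively, are optimal for $\varrho_\beta$. -/

import Mathlib

open scoped Kronecker ComplexOrder

/-- Operators on `ℂ^d ⊗ ℂ^d`, as matrices in the product basis. -/
abbrev BipartiteOp (d : ℕ) : Type := Matrix (Fin d × Fin d) (Fin d × Fin d) ℂ

/-- States (density matrices). -/
def IsState {d : ℕ} (ρ : BipartiteOp d) : Prop :=
  ρ.PosSemidef ∧ ρ.trace = 1

/-- The flip operator: `V (φ ⊗ ψ) = ψ ⊗ φ`. -/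
def flipOp (d : ℕ) : BipartiteOp d :=
  Matrix.of fun a b => if a = b.swap then 1 else 0

/-- Partial transposition `id ⊗ T` on the second tensor factor. -/
def partialTranspose {d : ℕ} (A : BipartiteOp d) : BipartiteOp d :=
  Matrix.of fun a b => A (a.1, b.2) (b.1, a.2)

/-- The Werner state `(I + β V) / (d² + d β)`. -/
noncomputable def wernerState (d : ℕ) (β : ℝ) : BipartiteOp d :=
  ((((d : ℝ) ^ 2 + d * β)⁻¹ : ℝ) : ℂ) • (1 + (β : ℂ) • flipOp d)

/-- The base-two logarithm of a Hermitian operator by functional calculus.  Since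
`Real.logb 2 0 = 0`, on a positive semidefinite operator it is the logarithm on the support and
zero on the kernel. -/
noncomputable def opLog {d : ℕ} (A : BipartiteOp d) : BipartiteOp d :=
  cfc (Real.logb 2) A

/-- Von Neumann entropy `S(ρ) = - tr (ρ log₂ ρ)` (with `0 log 0 = 0`). -/
noncomputable def vonNeumannEntropy {d : ℕ} (ρ : BipartiteOp d) : ℝ :=
  -(ρ * opLog ρ).trace.re

open Classical in
/-- Quantum relative entropy `S(ρ|σ) = tr (ρ log₂ ρ) - tr (ρ log₂ σ)`; it is `+∞` unless the
support of `ρ` is contained in the support of `σ`, that is, `ker σ ⊆ ker ρ`. -/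
noncomputable def relEntropy {d : ℕ} (ρ σ : BipartiteOp d) : EReal :=
  if ∀ v : Fin d × Fin d → ℂ, σ.mulVec v = 0 → ρ.mulVec v = 0 then
    (((ρ * opLog ρ).trace.re - (ρ * opLog σ).trace.re : ℝ) : EReal)
  else ⊤

/-- The operator norm for the Euclidean norm on `ℂ^d ⊗ ℂ^d`. For Hermitian `A` it is the
largest eigenvalue of `|A|`. -/
noncomputable def opNorm {d : ℕ} (A : BipartiteOp d) : ℝ :=
  ‖Matrix.toEuclideanCLM (𝕜 := ℂ) A‖

/-- `B₂(ρ,σ) = 2 log₂ d + S(ρ|σ) + log₂ ‖σ^Γ‖`. -/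
noncomputable def boundB2Pair {d : ℕ} (ρ σ : BipartiteOp d) : EReal :=
  ((2 * Real.logb 2 d : ℝ) : EReal) + relEntropy ρ σ
    + ((Real.logb 2 (opNorm (partialTranspose σ)) : ℝ) : EReal)

/-- `B₂(ρ)`, the infimum of `B₂(ρ,σ)` over all states `σ`. -/
noncomputable def boundB2 {d : ℕ} (ρ : BipartiteOp d) : EReal :=
  ⨅ σ : {σ : BipartiteOp d // IsState σ}, boundB2Pair ρ σ.1

/-- The state `σ` is optimal for `ρ`: it attains the minimum defining `B₂(ρ)`. -/
def IsOptimalFor {d : ℕ} (σ ρ : BipartiteOp d) : Prop :=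
  IsState σ ∧ boundB2Pair ρ σ = boundB2 ρ

noncomputable instance unitaryGroupMeasurableSpace (d : ℕ) :
    MeasurableSpace (Matrix.unitaryGroup (Fin d) ℂ) := borel _

instance unitaryGroupBorelSpace (d : ℕ) : BorelSpace (Matrix.unitaryGroup (Fin d) ℂ) := ⟨rfl⟩

instance unitaryGroupCompactSpace (d : ℕ) : CompactSpace (Matrix.unitaryGroup (Fin d) ℂ) := by
  have hcl : IsClosed (Matrix.unitaryGroup (Fin d) ℂ : Set (Matrix (Fin d) (Fin d) ℂ)) :=
    isClosed_unitary
  have hK : IsCompact (Set.univ.pi fun _ : Fin d => Set.univ.pi fun _ : Fin d =>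
      Metric.closedBall (0 : ℂ) 1) :=
    isCompact_univ_pi fun _ => isCompact_univ_pi fun _ => isCompact_closedBall _ _
  refine isCompact_iff_compactSpace.mp (hK.of_isClosed_subset hcl ?_)
  intro U hU i _ j _
  simpa using entry_norm_bound_of_unitary hU i j

/-- Haar measure on the unitary group `U(d)`, normalised to total mass one. -/
noncomputable def unitaryHaar (d : ℕ) :
    MeasureTheory.Measure (Matrix.unitaryGroup (Fin d) ℂ) :=
  MeasureTheory.Measure.haarMeasure ⊤

/-- `U ⊗ U` twirling: `∫ (U ⊗ U) σ (U ⊗ U)† dU`, the integral being taken entrywise. -/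
noncomputable def twirl {d : ℕ} (σ : BipartiteOp d) : BipartiteOp d :=
  Matrix.of fun a b => ∫ U : Matrix.unitaryGroup (Fin d) ℂ,
    ((U.1 ⊗ₖ U.1) * σ * (U.1 ⊗ₖ U.1).conjTranspose) a b ∂(unitaryHaar d)

/-- The weight `(d² + d)/2 · (1 + β)/(d² + dβ)` on the symmetric subspace of the Werner state
with parameter `β`. -/
noncomputable def wernerSymWeight (d : ℕ) (β : ℝ) : ℝ :=
  ((d : ℝ) ^ 2 + d) / 2 * ((1 + β) / ((d : ℝ) ^ 2 + d * β))

/-- The weight `(d² - d)/2 · (1 - β)/(d² + dβ)` on the antisymmetric subspace of the Werner state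
with parameter `β`. -/
noncomputable def wernerAntiWeight (d : ℕ) (β : ℝ) : ℝ :=
  ((d : ℝ) ^ 2 - d) / 2 * ((1 - β) / ((d : ℝ) ^ 2 + d * β))

/-! Write `p`, `q` for the weights of `ϱ_β` on the symmetric and antisymmetric subspaces, `P` for
either projection and `D` for its rank.

Twirling lowers both terms of `B₂(ϱ_β, ·)`. Since `ϱ_β` is a combination of the two projections, the
entropy term needs only `tr (P log σ)`. Jensen's inequality in an eigenbasis of `σ` bounds this by
`D log (tr (P σ) / D)`, the value at the twirl (`trace_projection_mul_log_le`). For the norm, `F =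
V^Γ` is `d` times the projection onto the maximally entangled vector. Pairing `σ^Γ` with `F` and
with `d - F` bounds `‖σ^Γ‖` below in terms of `tr σ` and `tr (V σ)`, which twirling preserves; for a
Werner state these bounds are its two eigenvalues in modulus (`max_div_le_opNorm_partialTranspose`).
The twirl is a Werner state because the commutant of all `U ⊗ U` is spanned by the identity and `V`
(`eq_combination_of_commute_kronecker_self`).

It remains to minimise `-p log (1+α) - q log (1-α) + log max(1, |1+αd|)`, the normalisations
cancelling because `p + q = 1`. The entropic part is convex with minimiser `p - q = (1+dβ)/(d+β)`.
The last term vanishes exactly on `[-2/d, 0]`, and outside it outgrows any entropic gain. The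
optimum is therefore `p - q` projected onto that interval, which yields the three cases. -/

open Matrix

/-! ### The flip operator and the spectral calculus of Werner states -/

section Flip

variable {d : ℕ}

theorem flipOp_apply (a b : Fin d × Fin d) :
    flipOp d a b = if a = b.swap then 1 else 0 := rfl

theorem flipOp_mul_apply (A : BipartiteOp d) (a b : Fin d × Fin d) :
    (flipOp d * A) a b = A a.swap b := by
  have h : ∀ b : Fin d × Fin d, a = b.swap ↔ b = a.swap := fun b =>
    ⟨fun h => by simp [h], fun h => by simp [h]⟩
  simp [Matrix.mul_apply, flipOp_apply, h]

theorem mul_flipOp_apply (A : BipartiteOp d) (a b : Fin d × Fin d) :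
    (A * flipOp d) a b = A a b.swap := by
  simp [Matrix.mul_apply, flipOp_apply]

theorem flipOp_mul_self : flipOp d * flipOp d = 1 := by
  ext a b
  rw [flipOp_mul_apply, flipOp_apply, Matrix.one_apply]
  simp [Prod.swap_inj]

theorem flipOp_isHermitian : (flipOp d).IsHermitian := by
  ext a b
  have h : b = a.swap ↔ a = b.swap := ⟨fun h => by simp [h], fun h => by simp [h]⟩
  simp [Matrix.conjTranspose_apply, flipOp_apply, h]

theorem trace_flipOp : (flipOp d).trace = d := by
  have h : ∀ a b : Fin d, (a = b ∧ b = a) ↔ b = a := fun a b =>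
    ⟨And.right, fun h => ⟨h.symm, h⟩⟩
  rw [Matrix.trace, Fintype.sum_prod_type]
  simp only [Matrix.diag_apply, flipOp_apply, Prod.swap_prod_mk, Prod.mk.injEq, h]
  simp

theorem trace_one_bipartiteOp : (1 : BipartiteOp d).trace = (d : ℂ) ^ 2 := by
  simp [Matrix.trace_one, sq]

/-- The functional calculus of a Hermitian involution. -/
theorem cfc_of_mul_self_eq_one {n : Type*} [Fintype n] [DecidableEq n] {M : Matrix n n ℂ}
    (hM : M.IsHermitian) (h1 : M * M = 1) (f : ℝ → ℝ) :
    cfc f M = (((f 1 + f (-1)) / 2 : ℝ) : ℂ) • (1 : Matrix n n ℂ)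
      + (((f 1 - f (-1)) / 2 : ℝ) : ℂ) • M := by
  have hsa : IsSelfAdjoint M := hM
  rcases isEmpty_or_nonempty n with hn | hn
  · exact Subsingleton.elim _ _
  have hspec : ∀ x ∈ spectrum ℝ M, x = 1 ∨ x = -1 := by
    intro x hx
    have h2 := spectrum.pow_mem_pow (𝕜 := ℝ) M 2 hx
    rw [pow_two M, h1, spectrum.one_eq] at h2
    have h3 : x ^ 2 = 1 := h2
    rcases mul_eq_zero.mp (show (x - 1) * (x + 1) = 0 by linear_combination h3) with h | h
    · exact Or.inl (sub_eq_zero.mp h)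
    · exact Or.inr (eq_neg_of_add_eq_zero_left h)
  -- On the points `1` and `-1`, every function agrees with an affine one.
  have hEq : (spectrum ℝ M).EqOn f
      (fun x => (f 1 + f (-1)) / 2 + (f 1 - f (-1)) / 2 * x) := by
    intro x hx
    rcases hspec x hx with rfl | rfl <;> simp only <;> ring
  rw [cfc_congr hEq, cfc_const_add _ _ _ (by fun_prop) hsa, cfc_const_mul_id _ _ hsa,
    Algebra.algebraMap_eq_smul_one]
  ext i j
  simp [Matrix.smul_apply]

/-- The projection onto the symmetric subspace. -/
noncomputable def symProj (d : ℕ) : BipartiteOp d := (1 / 2 : ℂ) • (1 + flipOp d)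

/-- The projection onto the antisymmetric subspace. -/
noncomputable def antiProj (d : ℕ) : BipartiteOp d := (1 / 2 : ℂ) • (1 - flipOp d)

theorem symProj_mul_self : symProj d * symProj d = symProj d := by
  simp only [symProj, smul_mul_smul_comm, add_mul, mul_add, one_mul, mul_one, flipOp_mul_self]
  module

theorem antiProj_mul_self : antiProj d * antiProj d = antiProj d := by
  simp only [antiProj, smul_mul_smul_comm, sub_mul, mul_sub, one_mul, mul_one, flipOp_mul_self]
  module

theorem symProj_mul_antiProj : symProj d * antiProj d = 0 := by
  simp only [symProj, antiProj, smul_mul_smul_comm, add_mul, mul_sub, one_mul, mul_one,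
    flipOp_mul_self]
  module

theorem antiProj_mul_symProj : antiProj d * symProj d = 0 := by
  simp only [symProj, antiProj, smul_mul_smul_comm, sub_mul, mul_add, one_mul, mul_one,
    flipOp_mul_self]
  module

theorem symProj_isHermitian : (symProj d).IsHermitian := by
  simp [symProj, Matrix.IsHermitian, Matrix.conjTranspose_smul, flipOp_isHermitian.eq]

theorem antiProj_isHermitian : (antiProj d).IsHermitian := by
  simp [antiProj, Matrix.IsHermitian, Matrix.conjTranspose_smul, flipOp_isHermitian.eq]

theorem Matrix.IsHermitian.posSemidef_of_mul_self {n : Type*} [Fintype n] {P : Matrix n n ℂ}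
    (hP : P.IsHermitian) (h : P * P = P) : P.PosSemidef := by
  have := Matrix.posSemidef_conjTranspose_mul_self P
  rwa [hP.eq, h] at this

theorem symProj_posSemidef : (symProj d).PosSemidef :=
  symProj_isHermitian.posSemidef_of_mul_self symProj_mul_self

theorem antiProj_posSemidef : (antiProj d).PosSemidef :=
  antiProj_isHermitian.posSemidef_of_mul_self antiProj_mul_self

theorem trace_symProj : (symProj d).trace = ((((d : ℝ) ^ 2 + d) / 2 : ℝ) : ℂ) := by
  simp only [symProj, trace_smul, trace_add, trace_flipOp, trace_one_bipartiteOp, smul_eq_mul]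
  push_cast; ring

theorem trace_antiProj : (antiProj d).trace = ((((d : ℝ) ^ 2 - d) / 2 : ℝ) : ℂ) := by
  simp only [antiProj, trace_smul, trace_sub, trace_flipOp, trace_one_bipartiteOp, smul_eq_mul]
  push_cast; ring

theorem wernerState_eq_projections (β : ℝ) :
    wernerState d β = (((1 + β) / ((d : ℝ) ^ 2 + d * β) : ℝ) : ℂ) • symProj d
      + (((1 - β) / ((d : ℝ) ^ 2 + d * β) : ℝ) : ℂ) • antiProj d := by
  simp only [wernerState, symProj, antiProj]
  push_cast
  match_scalars <;> ring

theorem werner_denom_pos (hd : 2 ≤ d) {β : ℝ} (hβ : -1 ≤ β) : 0 < (d : ℝ) ^ 2 + d * β := by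
  have h : (2 : ℝ) ≤ d := by exact_mod_cast hd
  nlinarith

theorem wernerState_isState (hd : 2 ≤ d) {β : ℝ} (hβ₁ : -1 ≤ β) (hβ₂ : β ≤ 1) :
    IsState (wernerState d β) := by
  have hc := werner_denom_pos hd hβ₁
  constructor
  · rw [wernerState_eq_projections]
    refine (symProj_posSemidef.smul ?_).add (antiProj_posSemidef.smul ?_)
    · exact_mod_cast div_nonneg (by linarith) hc.le
    · exact_mod_cast div_nonneg (by linarith) hc.le
  · simp only [wernerState, trace_smul, trace_add, trace_flipOp, trace_one_bipartiteOp,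
      smul_eq_mul]
    have : ((d : ℂ) ^ 2 + d * β) ≠ 0 := by exact_mod_cast hc.ne'
    push_cast
    rw [← mul_inv_cancel₀ this]
    ring

/-- The Werner state is an affine function of the flip, so its logarithm is a function of the flip,
evaluated only at `1` and `-1`. Continuity is automatic on a finite spectrum, and `Real.logb 2 0 =
0` covers a vanishing eigenvalue. -/
theorem opLog_wernerState (β : ℝ) :
    opLog (wernerState d β)
      = ((Real.logb 2 ((1 + β) / ((d : ℝ) ^ 2 + d * β)) : ℝ) : ℂ) • symProj d
      + ((Real.logb 2 ((1 - β) / ((d : ℝ) ^ 2 + d * β)) : ℝ) : ℂ) • antiProj d := by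
  have h1 : wernerState d β
      = cfc (fun v : ℝ => (1 + β * v) / ((d : ℝ) ^ 2 + d * β)) (flipOp d) := by
    refine Eq.trans ?_ (cfc_of_mul_self_eq_one flipOp_isHermitian flipOp_mul_self _).symm
    rw [wernerState]
    push_cast
    match_scalars <;> ring
  rw [opLog, h1]
  refine (cfc_comp (Real.logb 2) (fun v : ℝ => (1 + β * v) / ((d : ℝ) ^ 2 + d * β)) (flipOp d)
    flipOp_isHermitian ((Matrix.finite_real_spectrum.image _).continuousOn _)
    (Matrix.finite_real_spectrum.continuousOn _)).symm.trans
    ((cfc_of_mul_self_eq_one flipOp_isHermitian flipOp_mul_self _).trans ?_)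
  simp only [Function.comp, symProj, antiProj, mul_one, mul_neg, ← sub_eq_add_neg]
  push_cast
  match_scalars <;> ring

/-- Traces of products with a Werner state. -/
theorem trace_wernerState_mul (β : ℝ) (A : BipartiteOp d) :
    (wernerState d β * A).trace.re =
      (1 + β) / ((d : ℝ) ^ 2 + d * β) * (symProj d * A).trace.re
        + (1 - β) / ((d : ℝ) ^ 2 + d * β) * (antiProj d * A).trace.re := by
  rw [wernerState_eq_projections, add_mul, trace_add, smul_mul_assoc, smul_mul_assoc,
    trace_smul, trace_smul, smul_eq_mul, smul_eq_mul, Complex.add_re, Complex.re_ofReal_mul,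
    Complex.re_ofReal_mul]

theorem trace_symProj_mul_combination (s t : ℝ) :
    (symProj d * ((s : ℂ) • symProj d + (t : ℂ) • antiProj d)).trace.re
      = ((d : ℝ) ^ 2 + d) / 2 * s := by
  rw [mul_add, mul_smul_comm, mul_smul_comm, symProj_mul_self, symProj_mul_antiProj, smul_zero,
    add_zero, trace_smul, trace_symProj, smul_eq_mul, ← Complex.ofReal_mul, Complex.ofReal_re,
    mul_comm]

theorem trace_antiProj_mul_combination (s t : ℝ) :
    (antiProj d * ((s : ℂ) • symProj d + (t : ℂ) • antiProj d)).trace.re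
      = ((d : ℝ) ^ 2 - d) / 2 * t := by
  rw [mul_add, mul_smul_comm, mul_smul_comm, antiProj_mul_self, antiProj_mul_symProj, smul_zero,
    zero_add, trace_smul, trace_antiProj, smul_eq_mul, ← Complex.ofReal_mul, Complex.ofReal_re,
    mul_comm]

theorem trace_wernerState_mul_opLog (α β : ℝ) :
    (wernerState d β * opLog (wernerState d α)).trace.re =
      wernerSymWeight d β * Real.logb 2 ((1 + α) / ((d : ℝ) ^ 2 + d * α))
        + wernerAntiWeight d β * Real.logb 2 ((1 - α) / ((d : ℝ) ^ 2 + d * α)) := by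
  rw [trace_wernerState_mul, opLog_wernerState, trace_symProj_mul_combination,
    trace_antiProj_mul_combination, wernerSymWeight, wernerAntiWeight]
  ring

theorem vonNeumannEntropy_wernerState (β : ℝ) :
    vonNeumannEntropy (wernerState d β) =
      -(wernerAntiWeight d β * Real.logb 2 ((1 - β) / ((d : ℝ) ^ 2 + d * β)))
        - wernerSymWeight d β * Real.logb 2 ((1 + β) / ((d : ℝ) ^ 2 + d * β)) := by
  rw [vonNeumannEntropy, trace_wernerState_mul_opLog]
  ring

end Flip

/-! ### The commutant of the operators `U ⊗ U` -/

section Commutant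

variable {d : ℕ}

theorem kronecker_self_mul_apply (W : Matrix (Fin d) (Fin d) ℂ) (A : BipartiteOp d)
    (i j : Fin d) (b : Fin d × Fin d) :
    ((W ⊗ₖ W) * A) (i, j) b = ∑ k, ∑ l, W i k * W j l * A (k, l) b := by
  simp [Matrix.mul_apply, Fintype.sum_prod_type, Matrix.kroneckerMap_apply]

theorem mul_kronecker_self_apply (W : Matrix (Fin d) (Fin d) ℂ) (A : BipartiteOp d)
    (a : Fin d × Fin d) (k l : Fin d) :
    (A * (W ⊗ₖ W)) a (k, l) = ∑ i, ∑ j, A a (i, j) * (W i k * W j l) := by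
  simp [Matrix.mul_apply, Fintype.sum_prod_type, Matrix.kroneckerMap_apply]

/-- The unitary multiplying one basis vector by the imaginary unit. -/
theorem diagonal_phase_mem_unitaryGroup (m : Fin d) :
    Matrix.diagonal (fun n => if n = m then Complex.I else 1)
      ∈ Matrix.unitaryGroup (Fin d) ℂ := by
  rw [Matrix.mem_unitaryGroup_iff, Matrix.star_eq_conjTranspose, Matrix.diagonal_conjTranspose,
    Matrix.diagonal_mul_diagonal, ← Matrix.diagonal_one]
  congr 1
  ext n
  by_cases h : n = m <;> simp [h]

theorem perm_mem_unitaryGroup (π : Equiv.Perm (Fin d)) :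
    (Matrix.of fun a b => if a = π b then (1 : ℂ) else 0) ∈ Matrix.unitaryGroup (Fin d) ℂ := by
  rw [Matrix.mem_unitaryGroup_iff']
  ext a b
  simp [Matrix.mul_apply, Matrix.one_apply, Matrix.star_apply, apply_ite, eq_comm]

/-- This is `1 + (i - 1) P`, with `P` the projection onto the uniform vector. All its entries are
nonzero, so it relates matrix entries that phases and permutations leave independent. -/
theorem rankOne_perturbation_mem_unitaryGroup (hd : d ≠ 0) :
    (Matrix.of fun a b => (if a = b then (1 : ℂ) else 0) + (Complex.I - 1) / d)
      ∈ Matrix.unitaryGroup (Fin d) ℂ := by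
  have hd' : (d : ℂ) ≠ 0 := by exact_mod_cast hd
  rw [Matrix.mem_unitaryGroup_iff]
  ext a b
  simp only [Matrix.mul_apply, Matrix.star_apply, Matrix.of_apply, star_add, star_div₀, star_sub,
    Matrix.one_apply, apply_ite, star_one, star_zero, mul_add, add_mul, Finset.sum_add_distrib,
    Complex.star_def, Complex.conj_I, Complex.conj_natCast, ite_mul, mul_one, mul_zero,
    one_mul, zero_mul, Finset.sum_ite_eq, Finset.sum_const, Finset.card_univ, Fintype.card_fin,
    Finset.mem_univ, if_true, nsmul_eq_mul]
  have h : (d : ℂ) * ((Complex.I - 1) / d * ((-Complex.I - 1) / d))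
      + (Complex.I - 1) / d + (-Complex.I - 1) / d = 0 := by
    field_simp
    linear_combination -Complex.I_sq
  by_cases hab : a = b
  · subst hab
    simp only [if_true]
    linear_combination h
  · simp only [hab, if_false]
    linear_combination h

/-- An operator commuting with all `U ⊗ U` is a combination of the identity and the flip. -/
theorem eq_combination_of_commute_kronecker_self (hd : 2 ≤ d) {A : BipartiteOp d}
    (hA : ∀ W ∈ Matrix.unitaryGroup (Fin d) ℂ, (W ⊗ₖ W) * A = A * (W ⊗ₖ W)) :
    ∃ x y : ℂ, A = x • (1 : BipartiteOp d) + y • flipOp d := by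
  have hperm : ∀ (π : Equiv.Perm (Fin d)) (i j k l : Fin d),
      A (π i, π j) (π k, π l) = A (i, j) (k, l) := by
    intro π i j k l
    have h := congrFun (congrFun (hA _ (perm_mem_unitaryGroup π)) (π i, π j)) (k, l)
    rw [kronecker_self_mul_apply, mul_kronecker_self_apply] at h
    simpa [Finset.sum_ite_eq, ite_and] using h.symm
  have hzero : ∀ i j k l : Fin d, ¬(k = i ∧ l = j) → ¬(k = j ∧ l = i) →
      A (i, j) (k, l) = 0 := by
    intro i j k l h1 h2
    by_contra hne
    -- An index occurs in a pair zero, one or two times, giving the distinct phases `1`, `i`, `-1`.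
    -- Equal phases thus force the pairs to agree up to order; a sign `-1` would not separate zero
    -- from two.
    have hphase : ∀ m : Fin d, (if i = m then Complex.I else 1) * (if j = m then Complex.I else 1)
        = (if k = m then Complex.I else 1) * (if l = m then Complex.I else 1) := by
      intro m
      have h := congrFun (congrFun (hA _ (diagonal_phase_mem_unitaryGroup m)) (i, j)) (k, l)
      rw [Matrix.diagonal_kronecker_diagonal, Matrix.diagonal_mul, Matrix.mul_diagonal] at h
      exact mul_right_cancel₀ hne (h.trans (mul_comm _ _))
    have hI1 : Complex.I ≠ 1 := fun h => by simpa using congrArg Complex.re h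
    have hI2 : (1 : ℂ) ≠ Complex.I := hI1.symm
    have hI3 : (-1 : ℂ) ≠ Complex.I := fun h => by simpa using congrArg Complex.re h
    have hI4 : (-1 : ℂ) ≠ 1 := by norm_num
    have hi := hphase i
    have hj := hphase j
    by_cases hij : i = j <;> by_cases hki : k = i <;> by_cases hli : l = i <;>
      by_cases hkj : k = j <;> by_cases hlj : l = j <;> simp_all [Complex.I_mul_I]
  obtain ⟨e₀, e₁, he⟩ : ∃ e₀ e₁ : Fin d, e₀ ≠ e₁ :=
    ⟨⟨0, by omega⟩, ⟨1, by omega⟩, by simp [Fin.ext_iff]⟩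
  have hdiag : ∀ i, A (i, i) (i, i) = A (e₀, e₀) (e₀, e₀) := by
    intro i
    simpa using hperm (Equiv.swap e₀ i) e₀ e₀ e₀ e₀
  have htwo : ∀ i j : Fin d, i ≠ j → ∃ π : Equiv.Perm (Fin d), π e₀ = i ∧ π e₁ = j := by
    intro i j hij
    refine ⟨Equiv.swap (Equiv.swap e₀ i e₁) j * Equiv.swap e₀ i, ?_, by simp⟩
    have h : i ≠ Equiv.swap e₀ i e₁ := fun h =>
      he ((Equiv.swap e₀ i).injective (by rw [Equiv.swap_apply_left, ← h]))
    simp [Equiv.swap_apply_of_ne_of_ne h hij]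
  have hd0 : d ≠ 0 := by omega
  have hd' : (d : ℂ) ≠ 0 := by exact_mod_cast hd0
  -- Up to permutation three entries survive. Commutation with the rank-one perturbation gives the
  -- one relation between them, after cancelling two entries of `W` with imaginary part `1/d`.
  have hsum : A (e₀, e₀) (e₀, e₀) = A (e₀, e₁) (e₀, e₁) + A (e₀, e₁) (e₁, e₀) := by
    set W : Matrix (Fin d) (Fin d) ℂ :=
      Matrix.of fun a b => (if a = b then (1 : ℂ) else 0) + (Complex.I - 1) / d with hW
    have h := congrFun (congrFun (hA W (rankOne_perturbation_mem_unitaryGroup hd0)) (e₀, e₁))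
      (e₀, e₀)
    rw [kronecker_self_mul_apply, mul_kronecker_self_apply] at h
    have hl : ∑ k, ∑ l, W e₀ k * W e₁ l * A (k, l) (e₀, e₀)
        = W e₀ e₀ * W e₁ e₀ * A (e₀, e₀) (e₀, e₀) := by
      rw [Fintype.sum_eq_single e₀, Fintype.sum_eq_single e₀]
      · intro l hl
        rw [hzero _ _ _ _ (by tauto) (by tauto), mul_zero]
      · intro k hk
        refine Finset.sum_eq_zero fun l _ => ?_
        rw [hzero _ _ _ _ (by tauto) (by tauto), mul_zero]
    have hr : ∑ i, ∑ j, A (e₀, e₁) (i, j) * (W i e₀ * W j e₀)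
        = (A (e₀, e₁) (e₀, e₁) + A (e₀, e₁) (e₁, e₀)) * (W e₀ e₀ * W e₁ e₀) := by
      rw [Fintype.sum_eq_add e₀ e₁ he, Fintype.sum_eq_single e₁, Fintype.sum_eq_single e₀]
      · ring
      · intro l hl
        rw [hzero _ _ _ _ (by tauto) (by tauto), zero_mul]
      · intro l hl
        rw [hzero _ _ _ _ (by tauto) (by tauto), zero_mul]
      · intro k hk
        refine Finset.sum_eq_zero fun l _ => ?_
        rw [hzero _ _ _ _ (by tauto) (by tauto), zero_mul]
    rw [hl, hr] at h
    have h00 : W e₀ e₀ ≠ 0 := by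
      intro h0
      have := congrArg Complex.im h0
      simp [hW, Complex.div_natCast_im, hd0] at this
    have h10 : W e₁ e₀ ≠ 0 := by
      intro h0
      have := congrArg Complex.im h0
      simp [hW, Complex.div_natCast_im, hd0, he.symm] at this
    exact mul_right_cancel₀ (mul_ne_zero h00 h10) (by rw [← h, mul_comm])
  refine ⟨A (e₀, e₁) (e₀, e₁), A (e₀, e₁) (e₁, e₀), ?_⟩
  ext ⟨i, j⟩ ⟨k, l⟩
  simp only [Matrix.add_apply, Matrix.smul_apply, smul_eq_mul, Matrix.one_apply, flipOp_apply,
    Prod.swap_prod_mk, Prod.mk.injEq]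
  by_cases h1 : k = i ∧ l = j
  · obtain ⟨rfl, rfl⟩ := h1
    by_cases hkl : k = l
    · subst hkl
      simp [hdiag, hsum]
    · obtain ⟨π, rfl, rfl⟩ := htwo k l hkl
      simp [hperm, hkl, Ne.symm he]
  · by_cases h2 : k = j ∧ l = i
    · obtain ⟨rfl, rfl⟩ := h2
      have hkl : k ≠ l := fun h => h1 ⟨h, h.symm⟩
      obtain ⟨π, rfl, rfl⟩ := htwo l k (Ne.symm hkl)
      simp [hperm, he]
    · rw [hzero _ _ _ _ h1 h2]
      have h1' : ¬(i = k ∧ j = l) := fun h => h1 ⟨h.1.symm, h.2.symm⟩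
      have h2' : ¬(i = l ∧ j = k) := fun h => h2 ⟨h.2.symm, h.1.symm⟩
      simp [h1', h2']

end Commutant

/-! ### The twirl as a projection onto Werner states -/

section Twirl

variable {d : ℕ}

instance : MeasureTheory.IsProbabilityMeasure (unitaryHaar d) :=
  ⟨MeasureTheory.Measure.haarMeasure_self⟩

instance : (unitaryHaar d).IsMulLeftInvariant := by
  unfold unitaryHaar
  infer_instance

theorem continuous_conj_kronecker_self (σ : BipartiteOp d) :
    Continuous fun U : Matrix.unitaryGroup (Fin d) ℂ =>
      (U.1 ⊗ₖ U.1) * σ * (U.1 ⊗ₖ U.1).conjTranspose := by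
  have h : Continuous fun U : Matrix.unitaryGroup (Fin d) ℂ => U.1 ⊗ₖ U.1 :=
    continuous_matrix fun i j => by
      simp only [Matrix.kroneckerMap_apply]
      exact (continuous_subtype_val.matrix_elem _ _).mul (continuous_subtype_val.matrix_elem _ _)
  exact (h.matrix_mul continuous_const).matrix_mul h.matrix_conjTranspose

/-- Linear functionals commute with the twirling integral. -/
theorem linearMap_twirl (L : BipartiteOp d →ₗ[ℂ] ℂ) (σ : BipartiteOp d) :
    L (twirl σ) = ∫ U : Matrix.unitaryGroup (Fin d) ℂ,
      L ((U.1 ⊗ₖ U.1) * σ * (U.1 ⊗ₖ U.1).conjTranspose) ∂(unitaryHaar d) := by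
  have hL : ∀ A : BipartiteOp d, L A = ∑ a, ∑ b, A a b * L (Matrix.single a b 1) := by
    intro A
    conv_lhs => rw [Matrix.matrix_eq_sum_single A]
    simp only [map_sum]
    refine Finset.sum_congr rfl fun a _ => Finset.sum_congr rfl fun b _ => ?_
    rw [← smul_eq_mul, ← map_smul, Matrix.smul_single, smul_eq_mul, mul_one]
  have hint : ∀ a b, MeasureTheory.Integrable (fun U : Matrix.unitaryGroup (Fin d) ℂ =>
      ((U.1 ⊗ₖ U.1) * σ * (U.1 ⊗ₖ U.1).conjTranspose) a b * L (Matrix.single a b 1))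
      (unitaryHaar d) := fun a b =>
    (((continuous_conj_kronecker_self σ).matrix_elem a b).mul
      continuous_const).integrable_of_hasCompactSupport (HasCompactSupport.of_compactSpace _)
  rw [hL]
  simp_rw [hL (_ * _)]
  rw [MeasureTheory.integral_finsetSum _ fun a _ =>
    MeasureTheory.integrable_finsetSum _ fun b _ => hint a b]
  refine Finset.sum_congr rfl fun a _ => ?_
  rw [MeasureTheory.integral_finsetSum _ fun b _ => hint a b]
  refine Finset.sum_congr rfl fun b _ => ?_
  rw [MeasureTheory.integral_mul_const]
  rfl

theorem kronecker_self_mem_unitary (U : Matrix.unitaryGroup (Fin d) ℂ) :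
    (U.1 ⊗ₖ U.1).conjTranspose * (U.1 ⊗ₖ U.1) = 1 := by
  have h : U.1.conjTranspose * U.1 = 1 := Matrix.mem_unitaryGroup_iff'.mp U.2
  rw [Matrix.conjTranspose_kronecker, ← Matrix.mul_kronecker_mul, h, Matrix.one_kronecker_one]

/-- A trace against an operator commuting with all `U ⊗ U` is preserved by twirling. -/
theorem trace_mul_twirl {M : BipartiteOp d}
    (hM : ∀ U : Matrix.unitaryGroup (Fin d) ℂ, (U.1 ⊗ₖ U.1) * M = M * (U.1 ⊗ₖ U.1))
    (σ : BipartiteOp d) : (M * twirl σ).trace = (M * σ).trace := by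
  have h := linearMap_twirl
    ((Matrix.traceLinearMap (Fin d × Fin d) ℂ ℂ).comp (LinearMap.mulLeft ℂ M)) σ
  simp only [LinearMap.comp_apply, LinearMap.mulLeft_apply, Matrix.traceLinearMap_apply] at h
  rw [h]
  have hc : ∀ U : Matrix.unitaryGroup (Fin d) ℂ,
      (M * ((U.1 ⊗ₖ U.1) * σ * (U.1 ⊗ₖ U.1).conjTranspose)).trace = (M * σ).trace := by
    intro U
    rw [← mul_assoc, ← mul_assoc, ← hM, Matrix.trace_mul_comm, ← mul_assoc, ← mul_assoc,
      kronecker_self_mem_unitary, one_mul]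
  simp [hc]

/-- Conjugation by `W ⊗ W` translates the integration variable on the left by `W`, which Haar
measure does not see. -/
theorem twirl_commute (σ : BipartiteOp d) (W : Matrix (Fin d) (Fin d) ℂ)
    (hW : W ∈ Matrix.unitaryGroup (Fin d) ℂ) :
    (W ⊗ₖ W) * twirl σ = twirl σ * (W ⊗ₖ W) := by
  have hconj : (W ⊗ₖ W) * twirl σ * (W ⊗ₖ W).conjTranspose = twirl σ := by
    ext a b
    have h := linearMap_twirl ((Matrix.entryLinearMap ℂ ℂ a b).comp
      ((LinearMap.mulRight ℂ (W ⊗ₖ W).conjTranspose).comp (LinearMap.mulLeft ℂ (W ⊗ₖ W)))) σ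
    simp only [LinearMap.comp_apply, LinearMap.mulLeft_apply, LinearMap.mulRight_apply,
      Matrix.entryLinearMap_apply] at h
    rw [h]
    have h2 := MeasureTheory.integral_mul_left_eq_self (μ := unitaryHaar d)
      (fun U : Matrix.unitaryGroup (Fin d) ℂ =>
        ((U.1 ⊗ₖ U.1) * σ * (U.1 ⊗ₖ U.1).conjTranspose) a b) ⟨W, hW⟩
    refine Eq.trans ?_ h2
    refine MeasureTheory.integral_congr_ae (Filter.Eventually.of_forall fun U => ?_)
    simp only [Submonoid.coe_mul, Matrix.mul_kronecker_mul, Matrix.conjTranspose_mul, mul_assoc]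
  conv_rhs => rw [← hconj]
  rw [mul_assoc, kronecker_self_mem_unitary ⟨W, hW⟩, mul_one]

theorem flipOp_commute_kronecker_self (W : Matrix (Fin d) (Fin d) ℂ) :
    (W ⊗ₖ W) * flipOp d = flipOp d * (W ⊗ₖ W) := by
  ext ⟨i, j⟩ ⟨k, l⟩
  rw [flipOp_mul_apply, mul_flipOp_apply]
  simp [Matrix.kroneckerMap_apply, mul_comm]

theorem trace_twirl (σ : BipartiteOp d) : (twirl σ).trace = σ.trace := by
  simpa using trace_mul_twirl (M := 1) (fun U => by simp) σ

theorem trace_flipOp_mul_twirl (σ : BipartiteOp d) :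
    (flipOp d * twirl σ).trace = (flipOp d * σ).trace :=
  trace_mul_twirl (fun U => flipOp_commute_kronecker_self U.1) σ

theorem trace_symProj_mul_twirl (σ : BipartiteOp d) :
    (symProj d * twirl σ).trace = (symProj d * σ).trace := by
  simp [symProj, add_mul, trace_flipOp_mul_twirl, trace_twirl]

theorem trace_antiProj_mul_twirl (σ : BipartiteOp d) :
    (antiProj d * twirl σ).trace = (antiProj d * σ).trace := by
  simp [antiProj, sub_mul, trace_flipOp_mul_twirl, trace_twirl]

theorem Matrix.PosSemidef.trace_mul_nonneg_of_mul_self {n : Type*} [Fintype n]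
    {σ P : Matrix n n ℂ} (hσ : σ.PosSemidef) (hP : P.IsHermitian) (hPP : P * P = P) :
    0 ≤ (P * σ).trace := by
  have h := (hσ.mul_mul_conjTranspose_same P).trace_nonneg
  rwa [hP.eq, Matrix.trace_mul_comm, ← mul_assoc, hPP] at h

/-- Twirling a state yields a Werner state. -/
theorem exists_twirl_eq_wernerState (hd : 2 ≤ d) {σ : BipartiteOp d} (hσ : IsState σ) :
    ∃ α : ℝ, -1 ≤ α ∧ α ≤ 1 ∧ twirl σ = wernerState d α := by
  obtain ⟨x, y, hxy⟩ := eq_combination_of_commute_kronecker_self hd (twirl_commute σ)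
  have hs := hσ.1.trace_mul_nonneg_of_mul_self symProj_isHermitian symProj_mul_self
  have ha := hσ.1.trace_mul_nonneg_of_mul_self antiProj_isHermitian antiProj_mul_self
  have ht : (twirl σ).trace = 1 := (trace_twirl σ).trans hσ.2
  have hcomb : twirl σ = (x + y) • symProj d + (x - y) • antiProj d := by
    rw [hxy]; simp only [symProj, antiProj]; module
  have hs2 : (symProj d * twirl σ).trace = (x + y) * ((((d : ℝ) ^ 2 + d) / 2 : ℝ) : ℂ) := by
    rw [hcomb, mul_add, mul_smul_comm, mul_smul_comm, symProj_mul_self, symProj_mul_antiProj,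
      smul_zero, add_zero, trace_smul, trace_symProj, smul_eq_mul]
  have ha2 : (antiProj d * twirl σ).trace = (x - y) * ((((d : ℝ) ^ 2 - d) / 2 : ℝ) : ℂ) := by
    rw [hcomb, mul_add, mul_smul_comm, mul_smul_comm, antiProj_mul_self, antiProj_mul_symProj,
      smul_zero, zero_add, trace_smul, trace_antiProj, smul_eq_mul]
  rw [← trace_symProj_mul_twirl, hs2] at hs
  rw [← trace_antiProj_mul_twirl, ha2] at ha
  have hd' : (2 : ℝ) ≤ d := by exact_mod_cast hd
  have hds : 0 < ((d : ℝ) ^ 2 + d) / 2 := by nlinarith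
  have hda : 0 < ((d : ℝ) ^ 2 - d) / 2 := by nlinarith
  have hs3 : 0 ≤ x + y := by
    have := mul_nonneg hs (Complex.zero_le_real.mpr (inv_pos.mpr hds).le)
    rwa [mul_assoc, ← Complex.ofReal_mul, mul_inv_cancel₀ hds.ne', Complex.ofReal_one,
      mul_one] at this
  have ha3 : 0 ≤ x - y := by
    have := mul_nonneg ha (Complex.zero_le_real.mpr (inv_pos.mpr hda).le)
    rwa [mul_assoc, ← Complex.ofReal_mul, mul_inv_cancel₀ hda.ne', Complex.ofReal_one,
      mul_one] at this
  obtain ⟨s, hs0, hs4⟩ : ∃ s : ℝ, 0 ≤ s ∧ x + y = s :=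
    ⟨(x + y).re, (Complex.nonneg_iff.mp hs3).1, Complex.eq_re_of_ofReal_le hs3⟩
  obtain ⟨t, ht0, ht4⟩ : ∃ t : ℝ, 0 ≤ t ∧ x - y = t :=
    ⟨(x - y).re, (Complex.nonneg_iff.mp ha3).1, Complex.eq_re_of_ofReal_le ha3⟩
  have htr : s * (((d : ℝ) ^ 2 + d) / 2) + t * (((d : ℝ) ^ 2 - d) / 2) = 1 := by
    rw [hcomb, hs4, ht4, trace_add, trace_smul, trace_smul, trace_symProj, trace_antiProj, smul_eq_mul,
      smul_eq_mul] at ht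
    exact_mod_cast ht
  have hst : 0 < s + t := by
    by_contra! h
    have h1 : s = 0 := by linarith
    have h2 : t = 0 := by linarith
    simp [h1, h2] at htr
  -- The parameter is determined by `s : t = (1 + α) : (1 - α)`; the trace condition `htr` then
  -- fixes the normalisation.
  refine ⟨(s - t) / (s + t), ?_, ?_, ?_⟩
  · rw [le_div_iff₀ hst]; linarith
  · rw [div_le_iff₀ hst]; linarith
  · have hden : (d : ℝ) ^ 2 + d * ((s - t) / (s + t)) = 2 / (s + t) := by
      field_simp
      linarith
    rw [hcomb, hs4, ht4, wernerState_eq_projections, hden]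
    congr 3
    · field_simp; ring
    · field_simp; ring

end Twirl

/-! ### Bounds for the operator norm -/

section OperatorNorm

variable {d : ℕ}

/-- The diagonal entries are `⟨x, A x⟩` over the columns `x` of `M`, so Cauchy–Schwarz applies
termwise. With `M` a multiple of a projection this bounds `|tr (A M)|`. -/
theorem norm_trace_conjTranspose_mul_mul_le (A M : BipartiteOp d) :
    ‖(M.conjTranspose * A * M).trace‖ ≤ opNorm A * (M.conjTranspose * M).trace.re := by
  set x : Fin d × Fin d → EuclideanSpace ℂ (Fin d × Fin d) := fun b => WithLp.toLp 2 (M.col b)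
  have h : ∀ (N : BipartiteOp d) b, (M.conjTranspose * N * M) b b
      = inner ℂ (x b) (Matrix.toEuclideanCLM (𝕜 := ℂ) N (x b)) := by
    intro N b
    rw [EuclideanSpace.inner_eq_star_dotProduct, Matrix.ofLp_toEuclideanCLM, mul_assoc,
      Matrix.mul_apply, dotProduct]
    refine Finset.sum_congr rfl fun c _ => ?_
    rw [mul_comm]
    rfl
  have h1 : (M.conjTranspose * M).trace.re = ∑ b, ‖x b‖ ^ 2 := by
    rw [Matrix.trace, Complex.re_sum]
    refine Finset.sum_congr rfl fun b _ => ?_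
    have := h 1 b
    rw [mul_one, map_one, one_apply_eq_self] at this
    rw [Matrix.diag_apply, this, inner_self_eq_norm_sq_to_K]
    norm_cast
  rw [h1, Finset.mul_sum, Matrix.trace]
  refine (norm_sum_le _ _).trans (Finset.sum_le_sum fun b _ => ?_)
  rw [Matrix.diag_apply, h]
  refine (norm_inner_le_norm _ _).trans ?_
  have := (Matrix.toEuclideanCLM (𝕜 := ℂ) A).le_opNorm (x b)
  calc ‖x b‖ * ‖Matrix.toEuclideanCLM (𝕜 := ℂ) A (x b)‖
      ≤ ‖x b‖ * (opNorm A * ‖x b‖) := mul_le_mul_of_nonneg_left this (norm_nonneg _)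
    _ = opNorm A * ‖x b‖ ^ 2 := by ring

theorem opNorm_le_of_posSemidef {A : BipartiteOp d} {m : ℝ} (hm : 0 ≤ m)
    (h : (((m ^ 2 : ℝ) : ℂ) • (1 : BipartiteOp d) - A.conjTranspose * A).PosSemidef) :
    opNorm A ≤ m := by
  refine ContinuousLinearMap.opNorm_le_bound _ hm fun v => ?_
  have h1 := h.dotProduct_mulVec_nonneg (WithLp.ofLp v)
  have h2 : ((‖v‖ ^ 2 : ℝ) : ℂ) = star (WithLp.ofLp v) ⬝ᵥ WithLp.ofLp v := by
    have := inner_self_eq_norm_sq_to_K (𝕜 := ℂ) v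
    rw [EuclideanSpace.inner_eq_star_dotProduct, dotProduct_comm] at this
    rw [this]; norm_cast
  have h3 : ((‖Matrix.toEuclideanCLM (𝕜 := ℂ) A v‖ ^ 2 : ℝ) : ℂ)
      = star (WithLp.ofLp v) ⬝ᵥ ((A.conjTranspose * A) *ᵥ WithLp.ofLp v) := by
    have := inner_self_eq_norm_sq_to_K (𝕜 := ℂ) (Matrix.toEuclideanCLM (𝕜 := ℂ) A v)
    rw [EuclideanSpace.inner_eq_star_dotProduct, dotProduct_comm, Matrix.ofLp_toEuclideanCLM,
      Matrix.star_mulVec, ← Matrix.dotProduct_mulVec, Matrix.mulVec_mulVec] at this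
    rw [this]; norm_cast
  rw [Matrix.sub_mulVec, dotProduct_sub, Matrix.smul_mulVec, Matrix.one_mulVec, dotProduct_smul,
    ← h2, ← h3, smul_eq_mul, ← Complex.ofReal_mul, ← Complex.ofReal_sub,
    Complex.zero_le_real] at h1
  refine abs_le_of_sq_le_sq' ?_ (mul_nonneg hm (norm_nonneg _)) |>.2
  rw [mul_pow]
  linarith

end OperatorNorm

/-! ### The norm of the partial transpose -/

section PartialTranspose

variable {d : ℕ}

/-- These are the entries of `|Ω⟩⟨Ω|` for `Ω = ∑ eᵢ ⊗ eᵢ`, with `‖Ω‖² = d`. -/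
theorem partialTranspose_flipOp_apply (a b : Fin d × Fin d) :
    partialTranspose (flipOp d) a b
      = (if a.1 = a.2 then 1 else 0) * (if b.1 = b.2 then 1 else 0) := by
  simp only [partialTranspose, Matrix.of_apply, flipOp_apply, Prod.swap_prod_mk, Prod.mk.injEq,
    ite_and, mul_ite, mul_one, mul_zero]
  split_ifs <;> simp_all

theorem partialTranspose_wernerState (α : ℝ) :
    partialTranspose (wernerState d α) = ((((d : ℝ) ^ 2 + d * α)⁻¹ : ℝ) : ℂ) •
      (1 + (α : ℂ) • partialTranspose (flipOp d)) := by
  ext a b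
  have h : ((a.1, b.2) = (b.1, a.2)) ↔ (a = b) := by
    rw [Prod.mk.injEq, Prod.ext_iff]
    exact and_congr_right fun _ => eq_comm
  simp only [partialTranspose, wernerState, Matrix.of_apply, Matrix.smul_apply, Matrix.add_apply,
    Matrix.one_apply, h]

theorem partialTranspose_flipOp_isHermitian : (partialTranspose (flipOp d)).IsHermitian := by
  ext a b
  rw [Matrix.conjTranspose_apply, partialTranspose_flipOp_apply, partialTranspose_flipOp_apply]
  split_ifs <;> simp

theorem trace_partialTranspose (A : BipartiteOp d) : (partialTranspose A).trace = A.trace := rfl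

/-- Partial transposition preserves the pairing `tr (A B)`; this turns statements about `σ^Γ` into
ones about `tr (V σ)`. -/
theorem trace_partialTranspose_mul_flipOp (A : BipartiteOp d) :
    (partialTranspose A * partialTranspose (flipOp d)).trace = (flipOp d * A).trace := by
  have hr : (flipOp d * A).trace = ∑ i, ∑ k, A (k, i) (i, k) := by
    simp only [Matrix.trace, Matrix.diag_apply, flipOp_mul_apply, Fintype.sum_prod_type,
      Prod.swap_prod_mk]
  rw [hr, Finset.sum_comm]
  simp only [Matrix.trace, Matrix.diag_apply, Matrix.mul_apply, partialTranspose_flipOp_apply,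
    Fintype.sum_prod_type]
  simp [partialTranspose]

theorem partialTranspose_flipOp_mul_self :
    partialTranspose (flipOp d) * partialTranspose (flipOp d)
      = (d : ℂ) • partialTranspose (flipOp d) := by
  ext a b
  simp only [Matrix.mul_apply, partialTranspose_flipOp_apply, Matrix.smul_apply, smul_eq_mul,
    Fintype.sum_prod_type]
  split_ifs <;> simp

theorem trace_partialTranspose_flipOp : (partialTranspose (flipOp d)).trace = d := by
  rw [trace_partialTranspose, trace_flipOp]

theorem partialTranspose_flipOp_posSemidef : (partialTranspose (flipOp d)).PosSemidef := by
  have h := Matrix.posSemidef_vecMulVec_self_star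
    (fun a : Fin d × Fin d => if a.1 = a.2 then (1 : ℂ) else 0)
  convert h using 1
  ext a b
  rw [Matrix.vecMulVec_apply, partialTranspose_flipOp_apply, Pi.star_apply]
  split_ifs <;> simp

theorem smul_one_sub_partialTranspose_flipOp_mul_self :
    ((d : ℂ) • (1 : BipartiteOp d) - partialTranspose (flipOp d))
        * ((d : ℂ) • (1 : BipartiteOp d) - partialTranspose (flipOp d))
      = (d : ℂ) • ((d : ℂ) • (1 : BipartiteOp d) - partialTranspose (flipOp d)) := by
  simp only [sub_mul, mul_sub, smul_mul_assoc, mul_smul_comm, one_mul, mul_one,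
    partialTranspose_flipOp_mul_self]
  module

theorem smul_one_sub_partialTranspose_flipOp_isHermitian :
    ((d : ℂ) • (1 : BipartiteOp d) - partialTranspose (flipOp d)).IsHermitian := by
  simp [Matrix.IsHermitian, Matrix.conjTranspose_sub, Matrix.conjTranspose_smul,
    partialTranspose_flipOp_isHermitian.eq]

theorem smul_one_sub_partialTranspose_flipOp_posSemidef (hd : d ≠ 0) :
    ((d : ℂ) • (1 : BipartiteOp d) - partialTranspose (flipOp d)).PosSemidef := by
  have hd' : (d : ℂ) ≠ 0 := by exact_mod_cast hd
  have h := Matrix.posSemidef_conjTranspose_mul_self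
    ((d : ℂ) • (1 : BipartiteOp d) - partialTranspose (flipOp d))
  rw [smul_one_sub_partialTranspose_flipOp_isHermitian.eq,
    smul_one_sub_partialTranspose_flipOp_mul_self] at h
  have h2 := h.smul (show (0 : ℂ) ≤ (((d : ℝ)⁻¹ : ℝ) : ℂ) by
    exact_mod_cast inv_nonneg.mpr (Nat.cast_nonneg d))
  rwa [smul_smul, Complex.ofReal_inv, Complex.ofReal_natCast, inv_mul_cancel₀ hd', one_smul] at h2

/-- The expectation of `σ^Γ` in the maximally entangled state is bounded by its norm. -/
theorem norm_trace_flipOp_mul_le (hd : d ≠ 0) (σ : BipartiteOp d) :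
    ‖(flipOp d * σ).trace‖ ≤ opNorm (partialTranspose σ) * d := by
  have hd' : (0 : ℝ) < d := by exact_mod_cast Nat.pos_of_ne_zero hd
  have h := norm_trace_conjTranspose_mul_mul_le (partialTranspose σ)
    (partialTranspose (flipOp d))
  rw [partialTranspose_flipOp_isHermitian.eq, mul_assoc, Matrix.trace_mul_comm, mul_assoc,
    partialTranspose_flipOp_mul_self, mul_smul_comm, trace_smul, trace_smul,
    trace_partialTranspose_mul_flipOp, trace_partialTranspose_flipOp, smul_eq_mul, smul_eq_mul,
    norm_mul, Complex.norm_natCast, ← Nat.cast_mul, Complex.natCast_re, Nat.cast_mul] at h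
  refine le_of_mul_le_mul_left (h.trans_eq ?_) hd'
  ring

/-- The weight of `σ^Γ` on the complement of the maximally entangled state is bounded by its
norm. -/
theorem norm_trace_sub_trace_flipOp_mul_le (hd : d ≠ 0) (σ : BipartiteOp d) :
    ‖(d : ℂ) * σ.trace - (flipOp d * σ).trace‖
      ≤ opNorm (partialTranspose σ) * ((d : ℝ) ^ 3 - d) := by
  have hd' : (0 : ℝ) < d := by exact_mod_cast Nat.pos_of_ne_zero hd
  have h := norm_trace_conjTranspose_mul_mul_le (partialTranspose σ)
    ((d : ℂ) • (1 : BipartiteOp d) - partialTranspose (flipOp d))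
  have ht : ((d : ℂ) * ((d : ℂ) * (d : ℂ) ^ 2 - d)).re = d * ((d : ℝ) ^ 3 - d) := by
    rw [show ((d : ℂ) * ((d : ℂ) * (d : ℂ) ^ 2 - d)) = ((d * ((d : ℝ) ^ 3 - d) : ℝ) : ℂ) by
      push_cast; ring, Complex.ofReal_re]
  rw [smul_one_sub_partialTranspose_flipOp_isHermitian.eq, mul_assoc, Matrix.trace_mul_comm,
    mul_assoc, smul_one_sub_partialTranspose_flipOp_mul_self, mul_smul_comm, trace_smul,
    trace_smul, mul_sub, mul_smul_comm, mul_one, trace_sub, trace_sub, trace_smul, trace_smul,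
    trace_partialTranspose, trace_partialTranspose_mul_flipOp, trace_partialTranspose_flipOp,
    trace_one_bipartiteOp, smul_eq_mul, smul_eq_mul, smul_eq_mul, smul_eq_mul, ht,
    norm_mul, Complex.norm_natCast] at h
  refine le_of_mul_le_mul_left (h.trans_eq ?_) hd'
  ring

theorem opNorm_partialTranspose_wernerState_le (hd : 2 ≤ d) {α : ℝ} (hα : -1 ≤ α) :
    opNorm (partialTranspose (wernerState d α))
      ≤ max 1 |1 + α * d| / ((d : ℝ) ^ 2 + d * α) := by
  have hc := werner_denom_pos hd hα
  set c := ((d : ℝ) ^ 2 + d * α)⁻¹ with hc_def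
  set m := max 1 |1 + α * d| with hm_def
  set F := partialTranspose (flipOp d)
  have hc0 : 0 < c := inv_pos.mpr hc
  have hm1 : 1 ≤ m := le_max_left _ _
  have hm2 : (1 + α * d) ^ 2 ≤ m ^ 2 := by
    rw [← sq_abs]
    exact pow_le_pow_left₀ (abs_nonneg _) (le_max_right _ _) 2
  rw [div_eq_mul_inv, ← hc_def]
  refine opNorm_le_of_posSemidef (mul_nonneg (by linarith) hc0.le) ?_
  rw [partialTranspose_wernerState, ← hc_def]
  have hherm : (((c : ℝ) : ℂ) • (1 + (α : ℂ) • F)).conjTranspose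
      = ((c : ℝ) : ℂ) • (1 + (α : ℂ) • F) := by
    simp [Matrix.conjTranspose_smul, F, partialTranspose_flipOp_isHermitian.eq]
  rw [hherm]
  have hmul : (((c : ℝ) : ℂ) • (1 + (α : ℂ) • F)) * (((c : ℝ) : ℂ) • (1 + (α : ℂ) • F))
      = ((c ^ 2 : ℝ) : ℂ) • (1 + ((2 * α + α ^ 2 * d : ℝ) : ℂ) • F) := by
    simp only [smul_mul_smul_comm, add_mul, mul_add, one_mul, mul_one, F,
      partialTranspose_flipOp_mul_self]
    push_cast
    module
  rw [hmul]
  set k := 2 * α + α ^ 2 * d with hk_def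
  have hF : F.PosSemidef := partialTranspose_flipOp_posSemidef
  -- Here `(1 + αF)² = 1 + kF` and `kd = (1 + αd)² - 1`. The difference to be shown positive is `c²`
  -- times `(m² - 1) - kF`, or equally `(m² - (1 + αd)²) + k(d - F)`; the sign of `k` selects the
  -- form with nonnegative coefficients.
  rcases le_total k 0 with hk | hk
  · have h1 : (0 : ℂ) ≤ ((c ^ 2 * (m ^ 2 - 1) : ℝ) : ℂ) := by
      rw [Complex.zero_le_real]
      exact mul_nonneg (sq_nonneg _) (by nlinarith)
    have h2 : (0 : ℂ) ≤ ((c ^ 2 * -k : ℝ) : ℂ) := by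
      rw [Complex.zero_le_real]
      exact mul_nonneg (sq_nonneg _) (by linarith)
    convert (Matrix.PosSemidef.one.smul h1).add (hF.smul h2) using 1
    push_cast
    module
  · have h1 : (0 : ℂ) ≤ ((c ^ 2 * (m ^ 2 - (1 + α * d) ^ 2) : ℝ) : ℂ) := by
      rw [Complex.zero_le_real]
      exact mul_nonneg (sq_nonneg _) (by linarith)
    have h2 : (0 : ℂ) ≤ ((c ^ 2 * k : ℝ) : ℂ) := by
      rw [Complex.zero_le_real]
      exact mul_nonneg (sq_nonneg _) hk
    convert (Matrix.PosSemidef.one.smul h1).add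
      ((smul_one_sub_partialTranspose_flipOp_posSemidef (show d ≠ 0 by omega)).smul h2) using 1
    rw [hk_def]
    push_cast
    module

theorem trace_flipOp_mul_wernerState (α : ℝ) :
    (flipOp d * wernerState d α).trace
      = (((1 + α * d) / ((d : ℝ) ^ 2 + d * α) * d : ℝ) : ℂ) := by
  rw [wernerState, mul_smul_comm, mul_add, mul_one, mul_smul_comm, flipOp_mul_self, trace_smul,
    trace_add, trace_smul, trace_flipOp, trace_one_bipartiteOp, smul_eq_mul, smul_eq_mul]
  push_cast
  ring

/-- The norm of the partial transpose of a Werner state is minimal among the operators of unit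
trace with the same expectation of the flip. -/
theorem max_div_le_opNorm_partialTranspose (hd : 2 ≤ d) {α : ℝ} (hα : -1 ≤ α)
    {σ : BipartiteOp d} (ht : σ.trace = 1)
    (hf : (flipOp d * σ).trace = (flipOp d * wernerState d α).trace) :
    max 1 |1 + α * d| / ((d : ℝ) ^ 2 + d * α) ≤ opNorm (partialTranspose σ) := by
  have hc := werner_denom_pos hd hα
  have hd2 : (2 : ℝ) ≤ d := by exact_mod_cast hd
  have hd0 : d ≠ 0 := by omega
  have h1 := norm_trace_flipOp_mul_le hd0 σ
  have h2 := norm_trace_sub_trace_flipOp_mul_le hd0 σ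
  rw [ht, hf, trace_flipOp_mul_wernerState, mul_one,
    -- The weight off `Ω` is `d³ - d` times the eigenvalue `1/(d² + dα)`, so dividing by `d³ - d`
    -- leaves that eigenvalue.
    show ((d : ℂ) - (((1 + α * d) / ((d : ℝ) ^ 2 + d * α) * d : ℝ) : ℂ))
      = ((((d : ℝ) ^ 3 - d) * ((d : ℝ) ^ 2 + d * α)⁻¹ : ℝ) : ℂ) by
        rw [← Complex.ofReal_natCast, ← Complex.ofReal_sub]
        congr 1
        rw [eq_mul_inv_iff_mul_eq₀ hc.ne', sub_mul, mul_right_comm, div_mul_cancel₀ _ hc.ne']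
        ring, Complex.norm_real] at h2
  rw [hf, trace_flipOp_mul_wernerState, Complex.norm_real, Real.norm_eq_abs, abs_mul, abs_div,
    abs_of_pos hc, Nat.abs_cast] at h1
  have hd3 : 0 < (d : ℝ) ^ 3 - d := by nlinarith
  rw [Real.norm_eq_abs, abs_of_pos (mul_pos hd3 (inv_pos.mpr hc)), mul_comm] at h2
  rw [← max_div_div_right hc.le]
  refine max_le ?_ (le_of_mul_le_mul_right h1 (by linarith))
  rw [one_div]
  exact le_of_mul_le_mul_right h2 hd3

theorem opNorm_partialTranspose_wernerState (hd : 2 ≤ d) {α : ℝ} (hα₁ : -1 ≤ α) (hα₂ : α ≤ 1) :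
    opNorm (partialTranspose (wernerState d α))
      = max 1 |1 + α * d| / ((d : ℝ) ^ 2 + d * α) :=
  le_antisymm (opNorm_partialTranspose_wernerState_le hd hα₁)
    (max_div_le_opNorm_partialTranspose hd hα₁ (wernerState_isState hd hα₁ hα₂).2 rfl)

end PartialTranspose

/-! ### Jensen's inequality for the logarithm in an eigenbasis -/

section Jensen

variable {n : Type*} [Fintype n] [DecidableEq n]

/-- The weight of an eigenvector of `σ` in the operator `P`. -/
noncomputable def eigenWeight {σ : Matrix n n ℂ} (hσ : σ.IsHermitian) (P : Matrix n n ℂ)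
    (i : n) : ℝ :=
  ((star (hσ.eigenvectorUnitary : Matrix n n ℂ)) * P * hσ.eigenvectorUnitary) i i |>.re

theorem trace_mul_cfc_re {σ : Matrix n n ℂ} (hσ : σ.IsHermitian) (P : Matrix n n ℂ) (f : ℝ → ℝ) :
    (P * cfc f σ).trace.re = ∑ i, eigenWeight hσ P i * f (hσ.eigenvalues i) := by
  rw [hσ.cfc_eq, Matrix.IsHermitian.cfc, Unitary.conjStarAlgAut_apply, ← mul_assoc,
    Matrix.trace_mul_comm, ← mul_assoc, ← mul_assoc, Matrix.trace, Complex.re_sum]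
  refine Finset.sum_congr rfl fun i _ => ?_
  rw [Matrix.diag_apply, Matrix.mul_diagonal, eigenWeight]
  simp

/-- For a projection, `⟨e, P e⟩ = ‖P e‖²`. Hence the weights are nonnegative and vanish on
eigenvectors killed by `P`. -/
theorem eigenWeight_eq_sum {σ P : Matrix n n ℂ} (hσ : σ.IsHermitian) (hP : P.IsHermitian)
    (hPP : P * P = P) (i : n) :
    eigenWeight hσ P i = ∑ j, ‖(P *ᵥ ⇑(hσ.eigenvectorBasis i)) j‖ ^ 2 := by
  have h : star (hσ.eigenvectorUnitary : Matrix n n ℂ) * P * hσ.eigenvectorUnitary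
      = (P * (hσ.eigenvectorUnitary : Matrix n n ℂ)).conjTranspose
        * (P * (hσ.eigenvectorUnitary : Matrix n n ℂ)) := by
    rw [Matrix.conjTranspose_mul, hP.eq, Matrix.star_eq_conjTranspose, ← mul_assoc,
      mul_assoc _ P P, hPP]
  rw [eigenWeight, h, Matrix.mul_apply, Complex.re_sum]
  refine Finset.sum_congr rfl fun j _ => ?_
  rw [Matrix.conjTranspose_apply, Complex.star_def, ← Complex.normSq_eq_conj_mul_self,
    Complex.ofReal_re, Complex.normSq_eq_norm_sq]
  rfl

/-- Concavity of the logarithm: for a projection `P` whose range lies in the support of `σ`. -/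
theorem trace_projection_mul_log_le {σ P : Matrix n n ℂ} (hσ : σ.PosSemidef)
    (hP : P.IsHermitian) (hPP : P * P = P) {D : ℝ} (hD : P.trace = D) (hD0 : 0 < D)
    (hker : ∀ v : n → ℂ, σ *ᵥ v = 0 → P *ᵥ v = 0) :
    0 < (P * σ).trace.re ∧
      (P * cfc (Real.logb 2) σ).trace.re ≤ D * Real.logb 2 ((P * σ).trace.re / D) := by
  have hH := hσ.isHermitian
  set w := eigenWeight hH P
  set l := hH.eigenvalues
  have hw0 : ∀ i, 0 ≤ w i := fun i => by
    simp only [w, eigenWeight_eq_sum hH hP hPP]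
    positivity
  have hwl : ∀ i, l i = 0 → w i = 0 := by
    intro i hi
    have hz : P *ᵥ ⇑(hH.eigenvectorBasis i) = 0 := by
      refine hker _ ?_
      have hi' : hH.eigenvalues i = 0 := hi
      rw [hH.mulVec_eigenvectorBasis, hi', zero_smul]
    simp [w, eigenWeight_eq_sum hH hP hPP, hz]
  have hl0 : ∀ i, 0 ≤ l i := hσ.eigenvalues_nonneg
  have hsumD : ∑ i, w i = D := by
    have h := trace_mul_cfc_re hH P (fun _ => 1)
    have h1 : cfc (fun _ : ℝ => (1 : ℝ)) σ = 1 := cfc_const_one ℝ σ hH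
    rw [h1, mul_one, hD, Complex.ofReal_re] at h
    simpa using h.symm
  have hsumS : (P * σ).trace.re = ∑ i, w i * l i := by
    have h := trace_mul_cfc_re hH P id
    have h1 : cfc (id : ℝ → ℝ) σ = σ := cfc_id ℝ σ hH
    rwa [h1] at h
  have hpos : 0 < (P * σ).trace.re := by
    rw [hsumS]
    obtain ⟨i, -, hi⟩ := Finset.exists_lt_of_sum_lt (s := Finset.univ) (f := fun _ : n => (0 : ℝ))
      (g := w) (by simpa [hsumD] using hD0)
    refine Finset.sum_pos' (fun i _ => mul_nonneg (hw0 i) (hl0 i)) ⟨i, Finset.mem_univ _, ?_⟩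
    exact mul_pos hi ((hl0 i).lt_of_ne fun h => hi.ne' (hwl i h.symm))
  refine ⟨hpos, ?_⟩
  rw [trace_mul_cfc_re hH]
  set m := (P * σ).trace.re / D with hm_def
  have hm : 0 < m := div_pos hpos hD0
  have h2 : 0 < Real.log 2 := Real.log_pos (by norm_num)
  -- The tangent to the logarithm at the weighted mean `m` lies above it, and the linear corrections
  -- sum to zero. Zero eigenvalues carry no weight, so the convention `Real.logb 2 0 = 0` is
  -- harmless.
  have hterm : ∀ i, w i * Real.logb 2 (l i)
      ≤ w i * Real.logb 2 m + (w i * l i / m - w i) / Real.log 2 := by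
    intro i
    rcases (hl0 i).eq_or_lt with h | h
    · simp [hwl i h.symm]
    · have hlog := Real.log_le_sub_one_of_pos (div_pos h hm)
      rw [Real.log_div h.ne' hm.ne'] at hlog
      rw [Real.logb, Real.logb, ← sub_le_iff_le_add', ← mul_sub, ← sub_div, ← mul_div_assoc]
      refine div_le_div_of_nonneg_right ?_ h2.le
      calc w i * (Real.log (l i) - Real.log m) ≤ w i * (l i / m - 1) :=
            mul_le_mul_of_nonneg_left hlog (hw0 i)
        _ = _ := by ring
  refine (Finset.sum_le_sum fun i _ => hterm i).trans_eq ?_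
  rw [Finset.sum_add_distrib, ← Finset.sum_mul, hsumD, ← Finset.sum_div, Finset.sum_sub_distrib,
    ← Finset.sum_div, ← hsumS, hsumD, hm_def, div_div_cancel₀ hpos.ne', sub_self, zero_div,
    add_zero]

end Jensen

/-! ### Relative entropy, supports and reduction to Werner states -/

section RelativeEntropy

variable {d : ℕ}

theorem symProj_mulVec_eq_zero (hd : 2 ≤ d) {β : ℝ} (hβ : -1 < β) {v : Fin d × Fin d → ℂ}
    (hv : (wernerState d β).mulVec v = 0) : (symProj d).mulVec v = 0 := by
  have hc := werner_denom_pos hd hβ.le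
  have h := congrArg (symProj d).mulVec hv
  rw [Matrix.mulVec_mulVec, Matrix.mulVec_zero, wernerState_eq_projections, mul_add,
    mul_smul_comm, mul_smul_comm, symProj_mul_self, symProj_mul_antiProj, smul_zero, add_zero,
    Matrix.smul_mulVec] at h
  refine (smul_eq_zero.mp h).resolve_left ?_
  exact_mod_cast (div_pos (by linarith) hc).ne'

theorem antiProj_mulVec_eq_zero (hd : 2 ≤ d) {β : ℝ} (hβ₁ : -1 ≤ β) (hβ₂ : β < 1)
    {v : Fin d × Fin d → ℂ} (hv : (wernerState d β).mulVec v = 0) :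
    (antiProj d).mulVec v = 0 := by
  have hc := werner_denom_pos hd hβ₁
  have h := congrArg (antiProj d).mulVec hv
  rw [Matrix.mulVec_mulVec, Matrix.mulVec_zero, wernerState_eq_projections, mul_add,
    mul_smul_comm, mul_smul_comm, antiProj_mul_self, antiProj_mul_symProj, smul_zero, zero_add,
    Matrix.smul_mulVec] at h
  refine (smul_eq_zero.mp h).resolve_left ?_
  exact_mod_cast (div_pos (by linarith) hc).ne'

theorem dim_symmetric_pos (hd : 2 ≤ d) : 0 < ((d : ℝ) ^ 2 + d) / 2 := by
  have h : (2 : ℝ) ≤ d := by exact_mod_cast hd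
  nlinarith

theorem dim_antisymmetric_pos (hd : 2 ≤ d) : 0 < ((d : ℝ) ^ 2 - d) / 2 := by
  have h : (2 : ℝ) ≤ d := by exact_mod_cast hd
  nlinarith

theorem trace_symProj_mul_wernerState (α : ℝ) :
    (symProj d * wernerState d α).trace.re
      = ((d : ℝ) ^ 2 + d) / 2 * ((1 + α) / ((d : ℝ) ^ 2 + d * α)) := by
  rw [wernerState_eq_projections, trace_symProj_mul_combination]

theorem trace_antiProj_mul_wernerState (α : ℝ) :
    (antiProj d * wernerState d α).trace.re
      = ((d : ℝ) ^ 2 - d) / 2 * ((1 - α) / ((d : ℝ) ^ 2 + d * α)) := by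
  rw [wernerState_eq_projections, trace_antiProj_mul_combination]

/-- The logarithm of a state on the symmetric subspace, compared with that of its twirl. -/
theorem trace_symProj_mul_opLog_le (hd : 2 ≤ d) {α β : ℝ} (hα₁ : -1 ≤ α) (hβ : -1 < β)
    {σ : BipartiteOp d} (hσ : σ.PosSemidef)
    (ht : (symProj d * σ).trace = (symProj d * wernerState d α).trace)
    (hker : ∀ v, σ.mulVec v = 0 → (wernerState d β).mulVec v = 0) :
    -1 < α ∧ (symProj d * opLog σ).trace.re
      ≤ ((d : ℝ) ^ 2 + d) / 2 * Real.logb 2 ((1 + α) / ((d : ℝ) ^ 2 + d * α)) := by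
  have hD := dim_symmetric_pos hd
  have hc := werner_denom_pos hd hα₁
  obtain ⟨h1, h2⟩ := trace_projection_mul_log_le hσ symProj_isHermitian symProj_mul_self
    trace_symProj hD fun v hv => symProj_mulVec_eq_zero hd hβ (hker v hv)
  rw [ht, trace_symProj_mul_wernerState] at h1 h2
  rw [mul_div_cancel_left₀ _ hD.ne'] at h2
  refine ⟨?_, h2⟩
  have := (div_pos_iff_of_pos_right hc).mp (pos_of_mul_pos_right h1 hD.le)
  linarith

/-- The logarithm of a state on the antisymmetric subspace, compared with that of its twirl. -/
theorem trace_antiProj_mul_opLog_le (hd : 2 ≤ d) {α β : ℝ} (hα₁ : -1 ≤ α) (hβ₁ : -1 ≤ β)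
    (hβ₂ : β < 1) {σ : BipartiteOp d} (hσ : σ.PosSemidef)
    (ht : (antiProj d * σ).trace = (antiProj d * wernerState d α).trace)
    (hker : ∀ v, σ.mulVec v = 0 → (wernerState d β).mulVec v = 0) :
    α < 1 ∧ (antiProj d * opLog σ).trace.re
      ≤ ((d : ℝ) ^ 2 - d) / 2 * Real.logb 2 ((1 - α) / ((d : ℝ) ^ 2 + d * α)) := by
  have hD := dim_antisymmetric_pos hd
  have hc := werner_denom_pos hd hα₁
  obtain ⟨h1, h2⟩ := trace_projection_mul_log_le hσ antiProj_isHermitian antiProj_mul_self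
    trace_antiProj hD fun v hv => antiProj_mulVec_eq_zero hd hβ₁ hβ₂ (hker v hv)
  rw [ht, trace_antiProj_mul_wernerState] at h1 h2
  rw [mul_div_cancel_left₀ _ hD.ne'] at h2
  refine ⟨?_, h2⟩
  have := (div_pos_iff_of_pos_right hc).mp (pos_of_mul_pos_right h1 hD.le)
  linarith

/-- The support of one Werner state contains that of another unless the former is one of the two
normalised projections. -/
theorem wernerState_ker_le_iff (hd : 2 ≤ d) {α β : ℝ} (hα₁ : -1 ≤ α) (hα₂ : α ≤ 1)
    (hβ₁ : -1 ≤ β) (hβ₂ : β ≤ 1) :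
    (∀ v, (wernerState d α).mulVec v = 0 → (wernerState d β).mulVec v = 0) ↔
      (α = -1 → β = -1) ∧ (α = 1 → β = 1) := by
  constructor
  · intro hker
    have hσ := (wernerState_isState hd hα₁ hα₂).1
    constructor
    -- The comparison with the twirl, applied to the Werner state itself, already yields `-1 < α`.
    · intro h
      by_contra hne
      exact (trace_symProj_mul_opLog_le hd hα₁ (hβ₁.lt_of_ne (Ne.symm hne)) hσ rfl
        hker).1.ne' h
    · intro h
      by_contra hne
      exact (trace_antiProj_mul_opLog_le hd hα₁ hβ₁ (hβ₂.lt_of_ne hne) hσ rfl hker).1.ne h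
  · rintro ⟨h1, h2⟩ v hv
    rcases hα₁.eq_or_lt with h | h
    · rwa [h1 h.symm, h]
    rcases hα₂.eq_or_lt with h' | h'
    · rwa [h2 h', ← h']
    have hs := symProj_mulVec_eq_zero hd h hv
    have ha := antiProj_mulVec_eq_zero hd hα₁ h' hv
    rw [wernerState_eq_projections, Matrix.add_mulVec, Matrix.smul_mulVec, Matrix.smul_mulVec,
      hs, ha, smul_zero, smul_zero, add_zero]

/-- Twirling does not increase the relative entropy of a Werner state. -/
theorem relEntropy_wernerState_twirl_le (hd : 2 ≤ d) {α β : ℝ} (hα₁ : -1 ≤ α) (hα₂ : α ≤ 1)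
    (hβ₁ : -1 ≤ β) (hβ₂ : β ≤ 1) {σ : BipartiteOp d} (hσ : IsState σ)
    (htw : twirl σ = wernerState d α) :
    relEntropy (wernerState d β) (wernerState d α) ≤ relEntropy (wernerState d β) σ := by
  have hs : (symProj d * σ).trace = (symProj d * wernerState d α).trace := by
    rw [← htw, trace_symProj_mul_twirl]
  have ha : (antiProj d * σ).trace = (antiProj d * wernerState d α).trace := by
    rw [← htw, trace_antiProj_mul_twirl]
  by_cases hker : ∀ v, σ.mulVec v = 0 → (wernerState d β).mulVec v = 0
  · have hc := werner_denom_pos hd hβ₁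
    have hker' : ∀ v, (wernerState d α).mulVec v = 0 → (wernerState d β).mulVec v = 0 := by
      rw [wernerState_ker_le_iff hd hα₁ hα₂ hβ₁ hβ₂]
      constructor
      · intro h
        by_contra hne
        exact (trace_symProj_mul_opLog_le hd hα₁ (hβ₁.lt_of_ne (Ne.symm hne)) hσ.1 hs
          hker).1.ne' h
      · intro h
        by_contra hne
        exact (trace_antiProj_mul_opLog_le hd hα₁ hβ₁ (hβ₂.lt_of_ne hne) hσ.1 ha hker).1.ne h
    rw [relEntropy, if_pos hker', relEntropy, if_pos hker, EReal.coe_le_coe_iff]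
    refine sub_le_sub_left ?_ _
    rw [trace_wernerState_mul, trace_wernerState_mul, opLog_wernerState,
      trace_symProj_mul_combination, trace_antiProj_mul_combination]
    refine add_le_add ?_ ?_
    -- At `β = -1` the support condition says nothing about the symmetric subspace, but its
    -- coefficient is zero.
    · rcases hβ₁.eq_or_lt with h | h
      · simp [← h]
      · exact mul_le_mul_of_nonneg_left (trace_symProj_mul_opLog_le hd hα₁ h hσ.1 hs hker).2
          (div_nonneg (by linarith) hc.le)
    · rcases hβ₂.eq_or_lt with h | h
      · simp [h]
      · exact mul_le_mul_of_nonneg_left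
          (trace_antiProj_mul_opLog_le hd hα₁ hβ₁ h hσ.1 ha hker).2
          (div_nonneg (by linarith) hc.le)
  · rw [show relEntropy (wernerState d β) σ = ⊤ from if_neg hker]
    exact le_top

/-- Twirling does not increase `B₂(ϱ_β, ·)`. -/
theorem boundB2Pair_twirl_le (hd : 2 ≤ d) {β : ℝ} (hβ₁ : -1 ≤ β) (hβ₂ : β ≤ 1)
    {σ : BipartiteOp d} (hσ : IsState σ) :
    boundB2Pair (wernerState d β) (twirl σ) ≤ boundB2Pair (wernerState d β) σ := by
  obtain ⟨α, hα₁, hα₂, htw⟩ := exists_twirl_eq_wernerState hd hσ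
  have hf : (flipOp d * σ).trace = (flipOp d * wernerState d α).trace := by
    rw [← htw, trace_flipOp_mul_twirl]
  have hn : opNorm (partialTranspose (wernerState d α)) ≤ opNorm (partialTranspose σ) := by
    rw [opNorm_partialTranspose_wernerState hd hα₁ hα₂]
    exact max_div_le_opNorm_partialTranspose hd hα₁ hσ.2 hf
  have hpos : 0 < opNorm (partialTranspose (wernerState d α)) := by
    rw [opNorm_partialTranspose_wernerState hd hα₁ hα₂]
    exact div_pos (lt_max_of_lt_left one_pos) (werner_denom_pos hd hα₁)
  rw [htw]
  refine add_le_add (add_le_add le_rfl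
    (relEntropy_wernerState_twirl_le hd hα₁ hα₂ hβ₁ hβ₂ hσ htw)) ?_
  rw [EReal.coe_le_coe_iff]
  exact Real.logb_le_logb_of_le (by norm_num) hpos hn

theorem boundB2_wernerState_eq_iInf (hd : 2 ≤ d) {β : ℝ} (hβ₁ : -1 ≤ β) (hβ₂ : β ≤ 1) :
    boundB2 (wernerState d β) =
      ⨅ α : Set.Icc (-1 : ℝ) 1, boundB2Pair (wernerState d β) (wernerState d α) := by
  refine le_antisymm (le_iInf fun α => ?_) (le_iInf fun σ => ?_)
  · exact iInf_le (fun σ : {σ : BipartiteOp d // IsState σ} =>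
      boundB2Pair (wernerState d β) σ.1) ⟨_, wernerState_isState hd α.2.1 α.2.2⟩
  · obtain ⟨α, hα₁, hα₂, htw⟩ := exists_twirl_eq_wernerState hd σ.2
    refine (iInf_le _ ⟨α, hα₁, hα₂⟩).trans ?_
    have := boundB2Pair_twirl_le hd hβ₁ hβ₂ σ.2
    rwa [htw] at this

end RelativeEntropy

/-! ### The one-parameter minimisation -/

section Optimization

/-- The part of `B₂(ϱ_β, ϱ_α)` depending on `α`, with `p` and `q` the weights of `ϱ_β`. -/
noncomputable def wernerObjective (d : ℕ) (p q α : ℝ) : ℝ :=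
  -(p * Real.logb 2 (1 + α)) - q * Real.logb 2 (1 - α) + Real.logb 2 (max 1 |1 + α * d|)

/-- Tangent-line bound at `y`. The condition at `x = 0` excludes the default value `Real.logb 2 0 =
0`, where the true logarithm is `-∞`. -/
theorem mul_logb_sub_le {p x y : ℝ} (hp : 0 ≤ p) (hx : 0 ≤ x) (hx0 : x = 0 → p = 0)
    (hy : 0 < y) :
    p * Real.logb 2 x - p * Real.logb 2 y ≤ p * (x / y - 1) / Real.log 2 := by
  have h2 : 0 < Real.log 2 := Real.log_pos (by norm_num)
  rcases hx.eq_or_lt with h | h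
  · simp [hx0 h.symm]
  · have hlog := Real.log_le_sub_one_of_pos (div_pos h hy)
    rw [Real.log_div h.ne' hy.ne'] at hlog
    rw [Real.logb, Real.logb, ← mul_sub, ← sub_div, ← mul_div_assoc]
    exact div_le_div_of_nonneg_right (mul_le_mul_of_nonneg_left hlog hp) h2.le

/-- Gibbs' inequality for a two-point distribution. -/
theorem mul_logb_add_mul_logb_le {p q α : ℝ} (hp : 0 ≤ p) (hq : 0 ≤ q) (hpq : p + q = 1)
    (hα₁ : -1 ≤ α) (hα₂ : α ≤ 1) (hαp : α = -1 → p = 0) (hαq : α = 1 → q = 0) :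
    p * Real.logb 2 (1 + α) + q * Real.logb 2 (1 - α)
      ≤ p * Real.logb 2 (1 + (p - q)) + q * Real.logb 2 (1 - (p - q)) := by
  have h2 : 0 < Real.log 2 := Real.log_pos (by norm_num)
  have key : ∀ r x : ℝ, 0 ≤ r → 0 ≤ x → (x = 0 → r = 0) →
      r * Real.logb 2 x - r * Real.logb 2 (2 * r) ≤ (x / 2 - r) / Real.log 2 := by
    intro r x hr hx hxr
    -- For `r = 0` the comparison point `2r` is not positive, and the bound reduces to `0 ≤ x/2`.
    rcases hr.eq_or_lt with h | h
    · rw [← h]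
      simp only [zero_mul, sub_zero]
      positivity
    · refine (mul_logb_sub_le hr hx hxr (by linarith : 0 < 2 * r)).trans_eq ?_
      field_simp
  have h3 := key p (1 + α) hp (by linarith) fun h => hαp (by linarith)
  have h4 := key q (1 - α) hq (by linarith) fun h => hαq (by linarith)
  rw [show 1 + (p - q) = 2 * p by linarith, show 1 - (p - q) = 2 * q by linarith]
  have h5 : ((1 + α) / 2 - p) / Real.log 2 + ((1 - α) / 2 - q) / Real.log 2 = 0 := by
    rw [← add_div, div_eq_zero_iff]
    left
    linarith
  linarith

/-- The entropic part of the objective grows with the distance from its minimiser `p - q`. -/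
theorem mul_logb_add_mul_logb_le_of_between {p q α α₀ : ℝ} (hp : 0 ≤ p) (hq : 0 ≤ q)
    (hpq : p + q = 1) (hα₁ : -1 ≤ α) (hα₂ : α ≤ 1) (hαp : α = -1 → p = 0)
    (hαq : α = 1 → q = 0) (h₁ : -1 < α₀) (h₂ : α₀ < 1)
    (hbet : (α - α₀) * (p - q - α₀) ≤ 0) :
    p * Real.logb 2 (1 + α) + q * Real.logb 2 (1 - α)
      ≤ p * Real.logb 2 (1 + α₀) + q * Real.logb 2 (1 - α₀) := by
  have h2 : 0 < Real.log 2 := Real.log_pos (by norm_num)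
  have ha : 0 < 1 + α₀ := by linarith
  have hb : 0 < 1 - α₀ := by linarith
  have h3 := mul_logb_sub_le hp (by linarith : 0 ≤ 1 + α) (fun h => hαp (by linarith)) ha
  have h4 := mul_logb_sub_le hq (by linarith : 0 ≤ 1 - α) (fun h => hαq (by linarith)) hb
  -- Up to `log 2`, the slope at `α₀` is `p/(1+α₀) - q/(1-α₀) = (p - q - α₀)/(1 - α₀²)`, using `p +
  -- q = 1`.
  have h5 : p * ((1 + α) / (1 + α₀) - 1) / Real.log 2 + q * ((1 - α) / (1 - α₀) - 1) / Real.log 2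
      = (α - α₀) * (p - q - α₀) / ((1 + α₀) * (1 - α₀) * Real.log 2) := by
    have hq' : q = 1 - p := by linarith
    subst hq'
    field_simp
    ring
  have h6 : (α - α₀) * (p - q - α₀) / ((1 + α₀) * (1 - α₀) * Real.log 2) ≤ 0 :=
    div_nonpos_of_nonpos_of_nonneg hbet (by positivity)
  linarith

theorem logb_max_nonneg (x : ℝ) : 0 ≤ Real.logb 2 (max 1 |x|) :=
  Real.logb_nonneg (by norm_num) (le_max_left _ _)

theorem wernerObjective_of_mem {d : ℕ} (hd : 2 ≤ d) (p q : ℝ) {α : ℝ} (h₁ : -2 / (d : ℝ) ≤ α)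
    (h₂ : α ≤ 0) :
    wernerObjective d p q α = -(p * Real.logb 2 (1 + α)) - q * Real.logb 2 (1 - α) := by
  have hd' : (0 : ℝ) < d := by exact_mod_cast (by omega : 0 < d)
  rw [div_le_iff₀ hd'] at h₁
  have h : |1 + α * d| ≤ 1 := abs_le.mpr ⟨by linarith, by nlinarith⟩
  simp [wernerObjective, max_eq_left h]

theorem wernerObjective_min_of_nonneg {d : ℕ} (hd : 2 ≤ d) {p q α : ℝ} (hp : 0 ≤ p) (hq : 0 ≤ q)
    (hpq : p + q = 1) (hα₁ : -1 ≤ α) (hα₂ : α ≤ 1) (hαp : α = -1 → p = 0)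
    (hαq : α = 1 → q = 0) (h : 0 ≤ p - q) :
    wernerObjective d p q 0 ≤ wernerObjective d p q α := by
  have hd' : (2 : ℝ) ≤ d := by exact_mod_cast hd
  rw [wernerObjective_of_mem hd p q (div_nonpos_of_nonpos_of_nonneg (by norm_num) (by linarith))
    le_rfl, wernerObjective]
  rcases le_total α 0 with hα | hα
  · have := mul_logb_add_mul_logb_le_of_between hp hq hpq hα₁ hα₂ hαp hαq
      (by norm_num : (-1 : ℝ) < 0) one_pos (by nlinarith)
    have := logb_max_nonneg (1 + α * d)
    linarith
  -- To the right of `0` the entropic gain is at most `p log (1+α)`, which the norm term `log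
  -- (1+αd)` absorbs.
  · have h1 : Real.logb 2 (1 + α) ≤ Real.logb 2 (max 1 |1 + α * d|) := by
      refine Real.logb_le_logb_of_le (by norm_num) (by linarith) ?_
      refine le_max_of_le_right (le_trans ?_ (le_abs_self _))
      nlinarith
    have h2 : 0 ≤ Real.logb 2 (1 + α) := Real.logb_nonneg (by norm_num) (by linarith)
    have h3 : Real.logb 2 (1 - α) ≤ 0 :=
      Real.logb_nonpos (by norm_num) (by linarith) (by linarith)
    have h4 : p * Real.logb 2 (1 + α) ≤ Real.logb 2 (1 + α) :=
      mul_le_of_le_one_left h2 (by linarith)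
    have h5 : q * Real.logb 2 (1 - α) ≤ 0 := mul_nonpos_of_nonneg_of_nonpos hq h3
    simp only [add_zero, sub_zero, Real.logb_one, mul_zero, neg_zero]
    linarith

theorem wernerObjective_min_of_mem {d : ℕ} (hd : 2 ≤ d) {p q α : ℝ} (hp : 0 ≤ p) (hq : 0 ≤ q)
    (hpq : p + q = 1) (hα₁ : -1 ≤ α) (hα₂ : α ≤ 1) (hαp : α = -1 → p = 0)
    (hαq : α = 1 → q = 0) (h₁ : -2 / (d : ℝ) ≤ p - q) (h₂ : p - q ≤ 0) :
    wernerObjective d p q (p - q) ≤ wernerObjective d p q α := by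
  rw [wernerObjective_of_mem hd p q h₁ h₂, wernerObjective]
  have := mul_logb_add_mul_logb_le hp hq hpq hα₁ hα₂ hαp hαq
  have := logb_max_nonneg (1 + α * d)
  linarith

/-- Right of `-2/d` the entropic part already increases away from `p - q`; left of it the gain in
the `q` term is paid for by `log |1+αd|`. With `d ≥ 3` the point `-2/d` lies strictly above `-1`. -/
theorem wernerObjective_min_of_lt {d : ℕ} (hd : 3 ≤ d) {p q α : ℝ} (hp : 0 ≤ p) (hq : 0 ≤ q)
    (hpq : p + q = 1) (hα₁ : -1 ≤ α) (hα₂ : α ≤ 1) (hαp : α = -1 → p = 0)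
    (hαq : α = 1 → q = 0) (h : p - q ≤ -2 / (d : ℝ)) :
    wernerObjective d p q (-2 / d) ≤ wernerObjective d p q α := by
  have hd' : (3 : ℝ) ≤ d := by exact_mod_cast hd
  have hd0 : (0 : ℝ) < d := by linarith
  set α₀ : ℝ := -2 / (d : ℝ) with hα₀
  have hα₀d : α₀ * d = -2 := by rw [hα₀]; field_simp
  have ha₁ : -1 < α₀ := by rw [hα₀, lt_div_iff₀ hd0]; linarith
  have ha₂ : α₀ ≤ 0 := div_nonpos_of_nonpos_of_nonneg (by norm_num) hd0.le
  rw [wernerObjective_of_mem (by omega) p q le_rfl ha₂, wernerObjective]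
  rcases le_total α₀ α with hle | hle
  · have := mul_logb_add_mul_logb_le_of_between hp hq hpq hα₁ hα₂ hαp hαq ha₁ (by linarith)
      (mul_nonpos_of_nonneg_of_nonpos (sub_nonneg.mpr hle) (sub_nonpos.mpr h))
    have := logb_max_nonneg (1 + α * d)
    linarith
  · have h1 : p * Real.logb 2 (1 + α) ≤ p * Real.logb 2 (1 + α₀) := by
      rcases hα₁.eq_or_lt with h' | h'
      · simp [hαp h'.symm]
      · exact mul_le_mul_of_nonneg_left
          (Real.logb_le_logb_of_le (by norm_num) (by linarith) (by linarith)) hp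
    have h2 : Real.logb 2 (1 - α) - Real.logb 2 (1 - α₀) ≤ Real.logb 2 (max 1 |1 + α * d|) := by
      rw [← Real.logb_div (by linarith) (by linarith)]
      refine Real.logb_le_logb_of_le (by norm_num) (div_pos (by linarith) (by linarith)) ?_
      refine le_max_of_le_right (le_trans ?_ (neg_le_abs _))
      rw [div_le_iff₀ (by linarith)]
      -- With `δ = α₀ - α` and `α₀ d = -2`, the claim `1 - α ≤ -(1 + αd)(1 - α₀)` reads `δ ≤ δ(d +
      -- 2)`.
      have h3 : (α₀ - α) * (d + 1) ≥ 0 := mul_nonneg (by linarith) (by linarith)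
      nlinarith
    have h3 : 0 ≤ Real.logb 2 (1 - α) - Real.logb 2 (1 - α₀) :=
      sub_nonneg.mpr (Real.logb_le_logb_of_le (by norm_num) (by linarith) (by linarith))
    have h4 : q * (Real.logb 2 (1 - α) - Real.logb 2 (1 - α₀))
        ≤ Real.logb 2 (1 - α) - Real.logb 2 (1 - α₀) := mul_le_of_le_one_left h3 (by linarith)
    linarith

end Optimization

/-! ### The bound evaluated on Werner states -/

section Werner

variable {d : ℕ}

theorem wernerSymWeight_nonneg (hd : 2 ≤ d) {β : ℝ} (hβ : -1 ≤ β) : 0 ≤ wernerSymWeight d β :=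
  mul_nonneg (dim_symmetric_pos hd).le (div_nonneg (by linarith) (werner_denom_pos hd hβ).le)

theorem wernerAntiWeight_nonneg (hd : 2 ≤ d) {β : ℝ} (hβ₁ : -1 ≤ β) (hβ₂ : β ≤ 1) :
    0 ≤ wernerAntiWeight d β :=
  mul_nonneg (dim_antisymmetric_pos hd).le
    (div_nonneg (by linarith) (werner_denom_pos hd hβ₁).le)

theorem wernerSymWeight_add_wernerAntiWeight (hd : 2 ≤ d) {β : ℝ} (hβ : -1 ≤ β) :
    wernerSymWeight d β + wernerAntiWeight d β = 1 := by
  have hc := werner_denom_pos hd hβ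
  rw [wernerSymWeight, wernerAntiWeight, ← mul_div_assoc, ← mul_div_assoc, ← add_div,
    div_eq_one_iff_eq hc.ne']
  ring

theorem wernerSymWeight_sub_wernerAntiWeight (hd : 2 ≤ d) {β : ℝ} (hβ : -1 ≤ β) :
    wernerSymWeight d β - wernerAntiWeight d β = (1 + d * β) / (d + β) := by
  have hc := werner_denom_pos hd hβ
  have hd' : (2 : ℝ) ≤ d := by exact_mod_cast hd
  have hdb : 0 < d + β := by linarith
  rw [wernerSymWeight, wernerAntiWeight, ← mul_div_assoc, ← mul_div_assoc, ← sub_div,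
    div_eq_div_iff hc.ne' hdb.ne']
  ring

/-- The entropy contributes `(p + q) log (d² + dα)` and the norm `-log (d² + dα)`, which cancel. At
`α = ±1` the logarithm that cannot be split has weight zero. -/
theorem boundB2Pair_wernerState (hd : 2 ≤ d) {α β : ℝ} (hα₁ : -1 ≤ α) (hα₂ : α ≤ 1)
    (hβ₁ : -1 ≤ β) (hβ₂ : β ≤ 1) (h₁ : α = -1 → β = -1) (h₂ : α = 1 → β = 1) :
    boundB2Pair (wernerState d β) (wernerState d α) =
      ((2 * Real.logb 2 d - vonNeumannEntropy (wernerState d β)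
        + wernerObjective d (wernerSymWeight d β) (wernerAntiWeight d β) α : ℝ) : EReal) := by
  have hc := werner_denom_pos hd hα₁
  have hker := (wernerState_ker_le_iff hd hα₁ hα₂ hβ₁ hβ₂).mpr ⟨h₁, h₂⟩
  rw [boundB2Pair, relEntropy, if_pos hker, ← EReal.coe_add, ← EReal.coe_add,
    opNorm_partialTranspose_wernerState hd hα₁ hα₂, trace_wernerState_mul_opLog α,
    vonNeumannEntropy, wernerObjective,
    Real.logb_div (lt_max_of_lt_left one_pos).ne' hc.ne']
  have hs : wernerSymWeight d β * Real.logb 2 ((1 + α) / ((d : ℝ) ^ 2 + d * α))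
      = wernerSymWeight d β * (Real.logb 2 (1 + α) - Real.logb 2 ((d : ℝ) ^ 2 + d * α)) := by
    by_cases h : α = -1
    · simp [wernerSymWeight, h₁ h]
    · rw [Real.logb_div (fun h' => h (by linarith)) hc.ne']
  have ha : wernerAntiWeight d β * Real.logb 2 ((1 - α) / ((d : ℝ) ^ 2 + d * α))
      = wernerAntiWeight d β * (Real.logb 2 (1 - α) - Real.logb 2 ((d : ℝ) ^ 2 + d * α)) := by
    by_cases h : α = 1
    · simp [wernerAntiWeight, h₂ h]
    · rw [Real.logb_div (fun h' => h (by linarith)) hc.ne']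
  rw [hs, ha]
  congr 1
  linear_combination Real.logb 2 ((d : ℝ) ^ 2 + d * α) *
    wernerSymWeight_add_wernerAntiWeight hd hβ₁

/-- A minimiser of the objective over the Werner states is optimal among all states. -/
theorem boundB2_wernerState_of_min (hd : 2 ≤ d) {α₀ β : ℝ} (hα₁ : -1 ≤ α₀) (hα₂ : α₀ ≤ 1)
    (hβ₁ : -1 ≤ β) (hβ₂ : β ≤ 1) (h₁ : α₀ = -1 → β = -1) (h₂ : α₀ = 1 → β = 1)
    (hmin : ∀ α : ℝ, -1 ≤ α → α ≤ 1 → (α = -1 → wernerSymWeight d β = 0) →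
      (α = 1 → wernerAntiWeight d β = 0) →
      wernerObjective d (wernerSymWeight d β) (wernerAntiWeight d β) α₀
        ≤ wernerObjective d (wernerSymWeight d β) (wernerAntiWeight d β) α) :
    boundB2 (wernerState d β) =
      ((2 * Real.logb 2 d - vonNeumannEntropy (wernerState d β)
        + wernerObjective d (wernerSymWeight d β) (wernerAntiWeight d β) α₀ : ℝ) : EReal) ∧
    IsOptimalFor (wernerState d α₀) (wernerState d β) := by
  have hval := boundB2Pair_wernerState hd hα₁ hα₂ hβ₁ hβ₂ h₁ h₂
  have hb : boundB2 (wernerState d β)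
      = boundB2Pair (wernerState d β) (wernerState d α₀) := by
    rw [boundB2_wernerState_eq_iInf hd hβ₁ hβ₂]
    refine le_antisymm (iInf_le (fun α : Set.Icc (-1 : ℝ) 1 =>
      boundB2Pair (wernerState d β) (wernerState d α)) ⟨α₀, hα₁, hα₂⟩) (le_iInf fun α => ?_)
    obtain ⟨α, ha₁, ha₂⟩ := α
    by_cases hker : (α = -1 → β = -1) ∧ (α = 1 → β = 1)
    · rw [hval, boundB2Pair_wernerState hd ha₁ ha₂ hβ₁ hβ₂ hker.1 hker.2, EReal.coe_le_coe_iff]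
      refine add_le_add le_rfl (hmin α ha₁ ha₂ (fun h => ?_) fun h => ?_)
      · simp [wernerSymWeight, hker.1 h]
      · simp [wernerAntiWeight, hker.2 h]
    · have htop : boundB2Pair (wernerState d β) (wernerState d α) = ⊤ := by
        rw [← wernerState_ker_le_iff hd ha₁ ha₂ hβ₁ hβ₂] at hker
        rw [boundB2Pair, relEntropy, if_neg hker, EReal.coe_add_top, EReal.top_add_coe]
      rw [htop]
      exact le_top
  exact ⟨hb.trans hval, wernerState_isState hd hα₁ hα₂, hb.symm⟩

end Werner

/-! ### The three ranges of `β` -/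

theorem mainTheorem5 (d : ℕ) (hd : 2 ≤ d) (β : ℝ) (hβ₁ : -1 ≤ β) (hβ₂ : β ≤ 1) :
    -- `ϱ_W` is a state, with the stated entropy
    IsState (wernerState d β) ∧
    vonNeumannEntropy (wernerState d β) =
      -(wernerAntiWeight d β * Real.logb 2 ((1 - β) / ((d : ℝ) ^ 2 + d * β)))
        - wernerSymWeight d β * Real.logb 2 ((1 + β) / ((d : ℝ) ^ 2 + d * β)) ∧
    -- twirling reduces the optimisation over all states to Werner states
    (∀ σ : BipartiteOp d, IsState σ →
      IsState (twirl σ) ∧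
      (∃ α : ℝ, -1 ≤ α ∧ α ≤ 1 ∧ twirl σ = wernerState d α) ∧
      boundB2Pair (wernerState d β) (twirl σ) ≤ boundB2Pair (wernerState d β) σ) ∧
    boundB2 (wernerState d β) =
      ⨅ α : Set.Icc (-1 : ℝ) 1, boundB2Pair (wernerState d β) (wernerState d α) ∧
    -- the value of `B₂` and an optimal `σ` in the three ranges of `β`
    (-1 / (d : ℝ) ≤ β →
      boundB2 (wernerState d β) =
        ((2 * Real.logb 2 d - vonNeumannEntropy (wernerState d β) : ℝ) : EReal) ∧
      IsOptimalFor (wernerState d 0) (wernerState d β)) ∧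
    (-(3 * (d : ℝ)) / ((d : ℝ) ^ 2 + 2) ≤ β → β < -1 / (d : ℝ) →
      boundB2 (wernerState d β) =
        ((2 * Real.logb 2 d - vonNeumannEntropy (wernerState d β)
          - wernerSymWeight d β * Real.logb 2 (1 + (1 + d * β) / (d + β))
          - wernerAntiWeight d β * Real.logb 2 (1 - (1 + d * β) / (d + β)) : ℝ) : EReal) ∧
      IsOptimalFor (wernerState d ((1 + d * β) / (d + β))) (wernerState d β)) ∧
    (β < -(3 * (d : ℝ)) / ((d : ℝ) ^ 2 + 2) →
      boundB2 (wernerState d β) =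
        ((2 * Real.logb 2 d - vonNeumannEntropy (wernerState d β)
          - wernerSymWeight d β * Real.logb 2 (((d : ℝ) - 2) / d)
          - wernerAntiWeight d β * Real.logb 2 (((d : ℝ) + 2) / d) : ℝ) : EReal) ∧
      IsOptimalFor (wernerState d (-2 / (d : ℝ))) (wernerState d β)) := by
  have hd' : (2 : ℝ) ≤ d := by exact_mod_cast hd
  have hd0 : (0 : ℝ) < d := by linarith
  have hdb : 0 < d + β := by linarith
  have hp := wernerSymWeight_nonneg hd hβ₁
  have hq := wernerAntiWeight_nonneg hd hβ₁ hβ₂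
  have hpq := wernerSymWeight_add_wernerAntiWeight hd hβ₁
  have hdiff := wernerSymWeight_sub_wernerAntiWeight hd hβ₁
  refine ⟨wernerState_isState hd hβ₁ hβ₂, vonNeumannEntropy_wernerState β, fun σ hσ => ?_,
    boundB2_wernerState_eq_iInf hd hβ₁ hβ₂, fun h => ?_, fun h₁ h₂ => ?_, fun h => ?_⟩
  · obtain ⟨α, hα₁, hα₂, htw⟩ := exists_twirl_eq_wernerState hd hσ
    exact ⟨htw ▸ wernerState_isState hd hα₁ hα₂, ⟨α, hα₁, hα₂, htw⟩,
      boundB2Pair_twirl_le hd hβ₁ hβ₂ hσ⟩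
  · have hnn : 0 ≤ wernerSymWeight d β - wernerAntiWeight d β := by
      rw [hdiff]
      rw [div_le_iff₀ hd0] at h
      exact div_nonneg (by linarith) hdb.le
    obtain ⟨hb, ho⟩ := boundB2_wernerState_of_min hd (α₀ := 0) (by norm_num) (by norm_num) hβ₁ hβ₂
      (fun h => by norm_num at h) (fun h => by norm_num at h) fun α ha₁ ha₂ hs ha =>
        wernerObjective_min_of_nonneg hd hp hq hpq ha₁ ha₂ hs ha hnn
    refine ⟨hb.trans ?_, ho⟩
    simp [wernerObjective]
  -- Clearing denominators, the thresholds `-3d/(d²+2)` and `-1/d` for `β` are where `p - q` equals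
  -- `-2/d` and `0`.
  · have hlow : -2 / (d : ℝ) ≤ wernerSymWeight d β - wernerAntiWeight d β := by
      rw [hdiff, div_le_div_iff₀ hd0 hdb]
      rw [div_le_iff₀ (by positivity)] at h₁
      linarith
    have hup : wernerSymWeight d β - wernerAntiWeight d β ≤ 0 := by
      rw [hdiff]
      rw [lt_div_iff₀ hd0] at h₂
      exact div_nonpos_of_nonpos_of_nonneg (by linarith) hdb.le
    rw [← hdiff]
    obtain ⟨hb, ho⟩ := boundB2_wernerState_of_min hd
      (α₀ := wernerSymWeight d β - wernerAntiWeight d β) (by linarith) (by linarith) hβ₁ hβ₂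
      (fun h => by
        rw [hdiff, div_eq_iff hdb.ne'] at h
        have h3 : ((d : ℝ) + 1) * (β + 1) = 0 := by linarith
        have := (mul_eq_zero.mp h3).resolve_left (by linarith)
        linarith)
      (fun h => by linarith) fun α ha₁ ha₂ hs ha =>
        wernerObjective_min_of_mem hd hp hq hpq ha₁ ha₂ hs ha hlow hup
    refine ⟨hb.trans ?_, ho⟩
    rw [wernerObjective_of_mem hd _ _ hlow hup]
    congr 1
    ring
  · rw [lt_div_iff₀ (by positivity)] at h
    -- For `d = 2` the threshold is `-1`, so this range is empty.
    have hd3 : 3 ≤ d := by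
      by_contra hlt
      have h2 : d = 2 := by omega
      subst h2
      norm_num at h
      linarith
    have hd3' : (3 : ℝ) ≤ d := by exact_mod_cast hd3
    have hle : wernerSymWeight d β - wernerAntiWeight d β ≤ -2 / (d : ℝ) := by
      rw [hdiff, div_le_div_iff₀ hdb hd0]
      linarith
    have ha₁ : -1 < -2 / (d : ℝ) := by rw [lt_div_iff₀ hd0]; linarith
    have ha₂ : -2 / (d : ℝ) ≤ 0 := div_nonpos_of_nonpos_of_nonneg (by norm_num) hd0.le
    obtain ⟨hb, ho⟩ := boundB2_wernerState_of_min hd (α₀ := -2 / (d : ℝ)) ha₁.le (by linarith)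
      hβ₁ hβ₂ (fun h => absurd h ha₁.ne') (fun h => by linarith) fun α ha₁ ha₂ hs ha =>
        wernerObjective_min_of_lt hd3 hp hq hpq ha₁ ha₂ hs ha hle
    refine ⟨hb.trans ?_, ho⟩
    rw [wernerObjective_of_mem hd _ _ le_rfl ha₂,
      show 1 + -2 / (d : ℝ) = (d - 2) / d by field_simp; ring,
      show 1 - -2 / (d : ℝ) = (d + 2) / d by field_simp; ring]
    congr 1
    ring
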